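/- Let $n,k\ge 1$ and $m\ge 0$ be integers, $K=\mathbb{C}$, $P\subseteq\mathbb{R}^m$ a full-dimensional convex lattice polytope (with respect to $\mathbb{Z}^m$), and $\mathbf{a}'\in\mathbb{Z}^m$. Let $Z_k=\{u_0,\dots,u_{k-1}\}\subset\mathbb{C}^\times$ be the group of $k$-th roots of unity, $u_r=u_1^r$. An element $\sigma\in Z_k\wr S_n$ is a weighted permutation $i\mapsto u(\sigma,\sigma_i)\,\sigma_i$, with $\sigma_1\cdots\sigma_n\in S_n$ and $u(\sigma,i)\in Z_k$. Let $$K[P^{\times n}]=K\Big[t^d\prod_{i=1}^n\prod_{j=1}^m x_{i,j}^{(v_i)_j} : d\in\mathbb{N},\ v_1,\dots,v_n\in dP\cap\mathbb{Z}^m\Big]\subseteq K[t,x_{1,1}^{\pm1},\dots,x_{n,m}^{\pm1}],$$ on which $\sigma\in Z_k\wr S_n$ acts by algebra automorphisms fixing $t$ and sending $x_{i,j}$ to $u(\sigma,\sigma_i)\,x_{\sigma_i,j}$. It is bigraded by giving $t^d\prod_{i,j} x_{i,j}^{(v_i)_j}$ the projective degree $d$ and the combinatorial degree $\sum_i \mathbf{a}'\cdot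 v_i$, and the action preserves each (finite-dimensional) bigraded component $K[P^{\times n}]_{d,e}$. Put $\chi^{K[P^{\times n}]_d}(\sigma)=\sum_{e\in\mathbb{Z}} q^e\,\mathrm{tr}\big(\sigma\,|\,K[P^{\times n}]_{d,e}\big)\in\mathbb{C}[q^{\pm1}]$, and let $\chi^{K[P^{\times n}]}(\sigma)=\sum_{d\ge0}\sum_{e}t^dq^e\,\mathrm{tr}(\sigma\,|\,K[P^{\times n}]_{d,e})\in\mathbb{C}[q^{\pm1}][[t]]$ be the bigraded character. For $d\in\mathbb{N}$ let $F_d=[v^n : v\in dP\cap\mathbb{Z}^m]$ be the color rule (multiset of colors) in which each lattice point $v$ of $dP$ has multiplicity $n$, value $|v|=\sum_j v_j$ and weight $\rho(v)=q^{\mathbf{a}'\cdot v}$. The associated function on $Z_k\wr S_n$ is $$\chi^{F_d}(\sigma)=\sum_{f}\ \prod_{i=1}^n u(\sigma,i)^{|f_i|}\,\rho(f_i),$$ where $f=(f_1,\dots,f_n)$ runs over the tuples of colors that form a submultiset of $F_d$ and satisfy $f_i=f_j$ whenever $i$ and $j$ lie in the same cycle of $\sigma$. Then $$\chi^{K[P^{\times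 n}]}=\sum_{d\ge0}t^d\chi^{K[P^{\times n}]_d}=\sum_{d\ge0}t^d\chi^{F_d}.$$ In particular, let $\vec\gamma=(\gamma^0,\dots,\gamma^{k-1})$ be a sequence of partitions of total size $n$, and let $\chi^{\vec\gamma}$ be the irreducible character of $Z_k\wr S_n$ indexed by $\vec\gamma$, i.e. the character of the representation induced from $\prod_r Z_k\wr S_{|\gamma^r|}$ of the tensor product of the Specht modules of the $\gamma^r$, where on the $r$-th factor every copy of $Z_k$ acts by $u\mapsto u^r$. For each $d$ fix any linear order on the colors of $F_d$. Let $\mathrm{SSYT}_k(\vec\gamma,F_d)$ be the set of tuples $T=(T^0,\dots,T^{k-1})$ in which $T^r$ is a filling of the diagram of $\gamma^r$ by colors $v$ of $F_d$ with $|v|\equiv r \pmod k$, each used at most $n$ times, with weakly increasing rows and strictly increasing columns. Let $\rho(T)$ be the product of the weights of all entries of $T$. Then, with $\langle\chi,\psi\rangle=\frac{1}{n!\,k^n}\sum_{\sigma}\chi(\sigma)\overline{\psi(\sigma)}$, $$\big\langle\chi^{K[P^{\times n}]},\chi^{\vec\gamma}\big\rangle=\sum_{d\ge0}t^d\sum_{T\in\mathrm{SSYT}_k(\vec\gamma,F_d)}\rho(T).$$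 -/

import Mathlib

open scoped Pointwise

noncomputable section

/-! ### The wreath product of a cyclic group with a symmetric group -/

/-- The group `Z_k ≀ S_n`, with `Z_k` the group of `k`-th roots of unity in `ℂ`. An element `σ` is
the weighted permutation sending `i` to `u_{σ_i} σ_i`, where `σ.right : Equiv.Perm (Fin n)` is the
underlying permutation `i ↦ σ_i`, and `σ.left r = u(σ, r)` is the root of unity carried by the
index `r`, that is, the nonzero entry in row `r` of the matrix of `σ`. -/
abbrev WreathProduct (k n : ℕ) : Type :=
  (Fin n → rootsOfUnity k ℂ) ⋊[mulAutArrow] Equiv.Perm (Fin n)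

instance rootsOfUnityFintype (k : ℕ) [NeZero k] : Fintype (rootsOfUnity k ℂ) :=
  Fintype.ofFinite _

instance WreathProduct.instFintype (k n : ℕ) [NeZero k] : Fintype (WreathProduct k n) :=
  Fintype.ofEquiv _ SemidirectProduct.equivProd.symm

namespace WreathProduct

theorem mul_left_apply {k n : ℕ} (σ τ : WreathProduct k n) (r : Fin n) :
    (σ * τ).left r = σ.left r * τ.left (σ.right⁻¹ r) := rfl

/-- The root of unity `u(σ, r)`, as a unit of `ℂ`. -/
def root {k n : ℕ} (σ : WreathProduct k n) (r : Fin n) : ℂˣ := (σ.left r : ℂˣ)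

/-- The inner product `⟨χ, ψ⟩ = |Z_k ≀ S_n|⁻¹ ∑_σ χ(σ) conj (ψ(σ))` of a function `χ` with values in
a `ℂ`-algebra and a complex valued function `ψ`. -/
def inner {k n : ℕ} [NeZero k] {R : Type*} [CommRing R] [Algebra ℂ R]
    (χ : WreathProduct k n → R) (ψ : WreathProduct k n → ℂ) : R :=
  ((Fintype.card (WreathProduct k n) : ℂ)⁻¹) •
    ∑ σ : WreathProduct k n, (starRingEnd ℂ (ψ σ)) • χ σ

end WreathProduct

/-! ### Sequences of partitions and irreducible characters -/

/-- A sequence `γ = (γ⁰, …, γᵏ⁻¹)` of `k` partitions (Young diagrams) of total size `n`. The cell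
`(i, j)` of a Young diagram lies in row `i` and column `j`. -/
structure MultiPartition (k n : ℕ) where
  shape : Fin k → YoungDiagram
  card_eq : ∑ r, (shape r).card = n

namespace MultiPartition

variable {k n : ℕ} (γ : MultiPartition k n)

/-- The cells of `γ`: a cell is a pair of `r : Fin k` and a cell of `γ^r`. -/
abbrev Cell : Type := Σ r : Fin k, {c : ℕ × ℕ // c ∈ (γ.shape r).cells}

theorem card_cell : Fintype.card γ.Cell = n := by
  rw [Fintype.card_sigma]
  exact (Finset.sum_congr rfl fun r _ => Fintype.card_coe _).trans γ.card_eq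

/-- A numbering of the cells of `γ` by the letters on which `S_n` acts. -/
def numbering : γ.Cell ≃ Fin n := Fintype.equivFinOfCardEq γ.card_cell

/-- The index `r` such that the letter `i` is placed in `γ^r`. -/
def block (i : Fin n) : Fin k := (γ.numbering.symm i).1

/-- The row, within its partition, of the cell in which the letter `i` is placed. -/
def row (i : Fin n) : ℕ := (γ.numbering.symm i).2.1.1

/-- The column, within its partition, of the cell in which the letter `i` is placed. -/
def col (i : Fin n) : ℕ := (γ.numbering.symm i).2.1.2

open Classical in
/-- The row stabilizer of the numbering. -/
def rowGroup : Finset (Equiv.Perm (Fin n)) :=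
  Finset.univ.filter fun π => ∀ i, γ.block (π i) = γ.block i ∧ γ.row (π i) = γ.row i

open Classical in
/-- The column stabilizer of the numbering. -/
def colGroup : Finset (Equiv.Perm (Fin n)) :=
  Finset.univ.filter fun π => ∀ i, γ.block (π i) = γ.block i ∧ γ.col (π i) = γ.col i

/-- The element `∑_z ∏_i Ψ^{r(i)}(z_i)⁻¹ z` of the group algebra, where `z` ranges over `Z_k^n`,
`r(i)` is the block of `i`, and `Ψ^r(u) = u^r`. Up to the factor `k^n` it is the projector onto
the vectors on which the `i`-th copy of `Z_k` acts by the character `Ψ^{r(i)}`. -/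
def blockSymmetrizer [NeZero k] : MonoidAlgebra ℂ (WreathProduct k n) :=
  ∑ z : Fin n → rootsOfUnity k ℂ,
    MonoidAlgebra.single (SemidirectProduct.inl z)
      (((∏ i, ((z i : ℂˣ) ^ (γ.block i : ℕ))⁻¹ : ℂˣ)) : ℂ)

/-- The sum of the row stabilizer. -/
def rowSymmetrizer : MonoidAlgebra ℂ (WreathProduct k n) :=
  ∑ π ∈ γ.rowGroup, MonoidAlgebra.single (SemidirectProduct.inr π) 1

/-- The signed sum of the column stabilizer. -/
def colSymmetrizer : MonoidAlgebra ℂ (WreathProduct k n) :=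
  ∑ π ∈ γ.colGroup, MonoidAlgebra.single (SemidirectProduct.inr π) ((Equiv.Perm.sign π : ℤ) : ℂ)

/-- The Young symmetrizer of `γ` in the group algebra of `Z_k ≀ S_n`. -/
def youngSymmetrizer [NeZero k] : MonoidAlgebra ℂ (WreathProduct k n) :=
  γ.blockSymmetrizer * (γ.rowSymmetrizer * γ.colSymmetrizer)

/-- The irreducible representation of `Z_k ≀ S_n` indexed by `γ`: left multiplication on the left
ideal of the group algebra generated by the Young symmetrizer of `γ`. (This is the representation
induced from `∏_r Z_k ≀ S_{|γ^r|}` of the tensor product of the Specht modules of the `γ^r`,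
on the `r`-th of which every copy of `Z_k` acts through `Ψ^r`.) -/
def irreducibleRep [NeZero k] :
    Representation ℂ (WreathProduct k n)
      (Ideal.span {γ.youngSymmetrizer} : Ideal (MonoidAlgebra ℂ (WreathProduct k n))) :=
  Representation.ofModule' _

/-- The irreducible character `χ^γ` of `Z_k ≀ S_n`. -/
def irreducibleCharacter [NeZero k] (σ : WreathProduct k n) : ℂ :=
  γ.irreducibleRep.character σ

end MultiPartition

/-! ### Color rules and semistandard tableaux -/

/-- A color rule with colors in `α` and weights in `R`: a multiset of colors, given by the
multiplicity of each color, together with the value and the weight of each color. -/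
structure ColorRule (α R : Type*) where
  mult : α → ℕ
  value : α → ℤ
  weight : α → R

namespace ColorRule

variable {α R : Type*}

/-- `(f, σ)` is a coloring under `F`: the multiset of the `f i` is contained in `F`, and indices
in the same cycle of `σ` have the same color. -/
def IsColoring (F : ColorRule α R) {k n : ℕ} (σ : WreathProduct k n) (f : Fin n → α) : Prop :=
  (∀ c, Nat.card {i // f i = c} ≤ F.mult c) ∧
    ∀ i j, Equiv.Perm.SameCycle σ.right i j → f i = f j

/-- The function `χ^F` on `Z_k ≀ S_n` given by the color rule `F`: the sum over all colorings `f`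
of `σ` of `∏_i u(σ, i)^{p(f_i)} ρ(f_i)`. -/
def character [CommRing R] [Algebra ℂ R] (F : ColorRule α R) {k n : ℕ}
    (σ : WreathProduct k n) : R :=
  ∑ᶠ f ∈ {f : Fin n → α | F.IsColoring σ f},
    ∏ i, ((σ.root i ^ F.value (f i) : ℂˣ) : ℂ) • F.weight (f i)

open Classical in
/-- The submultiset `F_r` of the colors of `F` whose value is congruent to `r` modulo `k`. -/
def residue (F : ColorRule α R) (k : ℕ) (r : ℤ) : ColorRule α R where
  mult c := if F.value c ≡ r [ZMOD k] then F.mult c else 0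
  value := F.value
  weight := F.weight

/-- `T` is a semistandard tableau of shape `μ` and content in `F`, for the linear order `ord` on
the colors: each color is used at most as often as its multiplicity in `F` allows, rows are weakly
increasing, and columns are strictly increasing (away from the first, longest row). -/
structure IsSemistandard (F : ColorRule α R) (ord : LinearOrder α) (μ : YoungDiagram)
    (T : {c : ℕ × ℕ // c ∈ μ.cells} → α) : Prop where
  mult_le : ∀ c, Nat.card {x // T x = c} ≤ F.mult c
  row_weak : ∀ x y, x.1.1 = y.1.1 → x.1.2 < y.1.2 → ord.le (T x) (T y)
  col_strict : ∀ x y, x.1.2 = y.1.2 → x.1.1 < y.1.1 → ord.lt (T x) (T y)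

/-- The set `SSYT_k(γ, F) = SSYT(γ⁰, F_0) × ⋯ × SSYT(γᵏ⁻¹, F_{k-1})`. -/
def multiSSYT (F : ColorRule α R) (ord : LinearOrder α) {k n : ℕ} (γ : MultiPartition k n) :
    Set (∀ r : Fin k, {c : ℕ × ℕ // c ∈ (γ.shape r).cells} → α) :=
  {T | ∀ r : Fin k, (F.residue k (r : ℕ)).IsSemistandard ord (γ.shape r) (T r)}

/-- The weight `ρ(T)`: the product of the weights of all entries of `T`. -/
def tableauWeight [CommRing R] (F : ColorRule α R) {k n : ℕ} {γ : MultiPartition k n}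
    (T : ∀ r : Fin k, {c : ℕ × ℕ // c ∈ (γ.shape r).cells} → α) : R :=
  ∏ r, ∏ x, F.weight (T r x)

end ColorRule

/-! ### Polytopes and affine semigroup algebras -/

/-- The real vector with the same coordinates as an integer vector. -/
def latticeVec {ι : Type*} (v : ι → ℤ) : ι → ℝ := fun j => (v j : ℝ)

/-- `P` is a full-dimensional convex lattice polytope in `ℝ^m`. -/
def IsFullLatticePolytope {m : ℕ} (P : Set (Fin m → ℝ)) : Prop :=
  (∃ S : Finset (Fin m → ℤ), P = convexHull ℝ (latticeVec '' (S : Set (Fin m → ℤ)))) ∧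
    affineSpan ℝ P = ⊤

/-- The set `dQ ∩ ℤ^ι` of lattice points in the `d`-th dilation of `Q`. -/
def dilationPoints {ι : Type*} (Q : Set (ι → ℝ)) (d : ℕ) : Set (ι → ℤ) :=
  {v | latticeVec v ∈ (d : ℝ) • Q}

/-- The ring `K[t, x_i^{±1} : i ∈ ι]` with `K = ℂ`; the exponent `(d, v)` stands for the monomial
`t^d ∏_i x_i^{v_i}`. -/
abbrev MonomialRing (ι : Type*) : Type _ := AddMonoidAlgebra ℂ (ℕ × (ι → ℤ))

/-- The affine semigroup algebra `K[Q]`: the subalgebra generated by the monomials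
`x_{d,v} = t^d ∏_i x_i^{v_i}` with `d ∈ ℕ` and `v ∈ dQ ∩ ℤ^ι`. -/
def semigroupAlgebra {ι : Type*} (Q : Set (ι → ℝ)) : Subalgebra ℂ (MonomialRing ι) :=
  Algebra.adjoin ℂ
    {x | ∃ (d : ℕ) (v : ι → ℤ), v ∈ dilationPoints Q d ∧ x = AddMonoidAlgebra.single (d, v) 1}

/-- The cartesian power `P^{×n} ⊆ ℝ^{n m}`. -/
def cartesianPower (n : ℕ) {m : ℕ} (P : Set (Fin m → ℝ)) : Set (Fin n × Fin m → ℝ) :=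
  {x | ∀ i, (fun j => x (i, j)) ∈ P}

/-! ### The action of the wreath product -/

section Action

variable {k n m : ℕ}

/-- The action of `σ` on exponents: the exponent of `x_{i,j}` becomes the exponent of
`x_{σ_i,j}`. -/
def permExponent (σ : WreathProduct k n) (v : Fin n × Fin m → ℤ) : Fin n × Fin m → ℤ :=
  fun ij => v (σ.right⁻¹ ij.1, ij.2)

/-- The scalar `∏_i u(σ, σ_i)^{|v_i|}` by which `σ` multiplies the monomial with exponent `v`. -/
def actScalar (σ : WreathProduct k n) (v : Fin n × Fin m → ℤ) : ℂˣ :=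
  ∏ i, σ.root (σ.right i) ^ (∑ j, v (i, j))

theorem actScalar_add (σ : WreathProduct k n) (v w : Fin n × Fin m → ℤ) :
    actScalar σ (v + w) = actScalar σ v * actScalar σ w := by
  simp [actScalar, Finset.sum_add_distrib, zpow_add, Finset.prod_mul_distrib]

/-- The algebra endomorphism of `K[t, x_{1,1}^{±1}, …, x_{n,m}^{±1}]` by which `σ` acts: it fixes
`t` and maps `x_{i,j}` to `u(σ, σ_i) x_{σ_i,j}`. -/
def wreathAct (σ : WreathProduct k n) :
    MonomialRing (Fin n × Fin m) →ₐ[ℂ] MonomialRing (Fin n × Fin m) :=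
  AddMonoidAlgebra.lift ℂ _ _
    { toFun := fun e => AddMonoidAlgebra.single
        (e.toAdd.1, permExponent σ e.toAdd.2) (actScalar σ e.toAdd.2 : ℂ)
      map_one' := by
        have h : permExponent σ (0 : Fin n × Fin m → ℤ) = 0 := rfl
        simp [actScalar, h, AddMonoidAlgebra.one_def, ← Prod.zero_eq_mk]
      map_mul' := fun e f => by
        rw [AddMonoidAlgebra.single_mul_single, toAdd_mul, Prod.snd_add, actScalar_add,
          Units.val_mul]
        rfl }

theorem wreathAct_single (σ : WreathProduct k n) (d : ℕ) (v : Fin n × Fin m → ℤ) (c : ℂ) :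
    wreathAct σ (AddMonoidAlgebra.single (d, v) c) =
      AddMonoidAlgebra.single (d, permExponent σ v) (c * (actScalar σ v : ℂ)) := by
  simp [wreathAct, AddMonoidAlgebra.lift_single]

theorem wreathAct_t (σ : WreathProduct k n) :
    wreathAct σ (AddMonoidAlgebra.single (1, (0 : Fin n × Fin m → ℤ)) 1) =
      AddMonoidAlgebra.single (1, 0) 1 := by
  rw [wreathAct_single]
  have h : permExponent σ (0 : Fin n × Fin m → ℤ) = 0 := rfl
  simp [actScalar, h]

theorem wreathAct_x (σ : WreathProduct k n) (i : Fin n) (j : Fin m) :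
    wreathAct σ (AddMonoidAlgebra.single (0, Pi.single (i, j) 1) 1) =
      (σ.root (σ.right i) : ℂ) •
        AddMonoidAlgebra.single (0, Pi.single (σ.right i, j) 1) 1 := by
  rw [wreathAct_single]
  have h : permExponent σ (Pi.single (i, j) (1 : ℤ)) = Pi.single (σ.right i, j) 1 := by
    funext ⟨a, b⟩
    simp only [permExponent, Pi.single_apply, Prod.mk.injEq, Equiv.Perm.inv_eq_iff_eq]
  have h' : actScalar σ (Pi.single (i, j) (1 : ℤ)) = σ.root (σ.right i) := by
    unfold actScalar
    rw [Finset.prod_eq_single i]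
    · simp [Pi.single_apply]
    · intro b _ hb
      simp [hb]
    · simp
  simp [h, h']

theorem wreathAct_one (f : MonomialRing (Fin n × Fin m)) :
    wreathAct (1 : WreathProduct k n) f = f := by
  have h : (wreathAct (1 : WreathProduct k n) : MonomialRing (Fin n × Fin m) →ₐ[ℂ] _) =
      AlgHom.id ℂ _ := by
    refine AddMonoidAlgebra.algHom_ext ?_ (by ext)
    rintro ⟨d, v⟩
    rw [wreathAct_single]
    have h : permExponent (1 : WreathProduct k n) v = v := rfl
    simp [h, actScalar, WreathProduct.root]
  rw [h]; rfl

theorem wreathAct_mul (σ τ : WreathProduct k n) (f : MonomialRing (Fin n × Fin m)) :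
    wreathAct (σ * τ) f = wreathAct σ (wreathAct τ f) := by
  have h : (wreathAct (σ * τ) : MonomialRing (Fin n × Fin m) →ₐ[ℂ] _) =
      (wreathAct σ).comp (wreathAct τ) := by
    refine AddMonoidAlgebra.algHom_ext ?_ (by ext)
    rintro ⟨d, v⟩
    rw [AlgHom.comp_apply, wreathAct_single, wreathAct_single, wreathAct_single]
    have h : permExponent (σ * τ) v = permExponent σ (permExponent τ v) := by
      funext ij
      simp [permExponent, mul_inv_rev]
    have h' : actScalar (σ * τ) v = actScalar τ v * actScalar σ (permExponent τ v) := by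
      unfold actScalar permExponent
      rw [← Equiv.prod_comp τ.right (fun i => σ.root (σ.right i) ^ _), ← Finset.prod_mul_distrib]
      refine Finset.prod_congr rfl fun i _ => ?_
      simp [WreathProduct.root, WreathProduct.mul_left_apply, mul_zpow, mul_comm]
    simp [h, h']
  rw [h]; rfl

/-- The representation of `Z_k ≀ S_n` on `K[t, x_{1,1}^{±1}, …, x_{n,m}^{±1}]`. -/
def wreathRep (k n m : ℕ) :
    Representation ℂ (WreathProduct k n) (MonomialRing (Fin n × Fin m)) where
  toFun σ := (wreathAct σ).toLinearMap
  map_one' := LinearMap.ext wreathAct_one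
  map_mul' σ τ := LinearMap.ext (wreathAct_mul σ τ)

/-- The weight vector `a = (a')^{×n}`. -/
def weightVector (n : ℕ) {m : ℕ} (a' : Fin m → ℤ) : Fin n × Fin m → ℤ := fun ij => a' ij.2

/-- The component `K[P^{×n}]_{d,j}` of projective degree `d` and combinatorial degree `j`: the
elements of `K[P^{×n}]` all of whose monomials `t^d x^v` satisfy `a · v = j`, for
`a = (a')^{×n}`. -/
def bigradedPiece (n : ℕ) {m : ℕ} (P : Set (Fin m → ℝ)) (a' : Fin m → ℤ) (d : ℕ) (j : ℤ) :
    Submodule ℂ (MonomialRing (Fin n × Fin m)) :=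
  Subalgebra.toSubmodule (semigroupAlgebra (cartesianPower n P)) ⊓
    AddMonoidAlgebra.gradeBy ℂ
      (fun e : ℕ × (Fin n × Fin m → ℤ) => (e.1, weightVector n a' ⬝ᵥ e.2)) (d, j)

theorem permExponent_mem (σ : WreathProduct k n) (P : Set (Fin m → ℝ)) {d : ℕ}
    {v : Fin n × Fin m → ℤ} (hv : v ∈ dilationPoints (cartesianPower n P) d) :
    permExponent σ v ∈ dilationPoints (cartesianPower n P) d := by
  obtain ⟨x, hx, hxv⟩ := hv
  refine ⟨fun ij => x (σ.right⁻¹ ij.1, ij.2), fun i => hx (σ.right⁻¹ i), ?_⟩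
  funext ij
  exact congrFun hxv (σ.right⁻¹ ij.1, ij.2)

theorem wreathAct_mem_semigroupAlgebra (σ : WreathProduct k n) (P : Set (Fin m → ℝ))
    {f : MonomialRing (Fin n × Fin m)} (hf : f ∈ semigroupAlgebra (cartesianPower n P)) :
    wreathAct σ f ∈ semigroupAlgebra (cartesianPower n P) := by
  have h : semigroupAlgebra (cartesianPower n P) ≤
      (semigroupAlgebra (cartesianPower n P)).comap (wreathAct σ) := by
    refine Algebra.adjoin_le ?_
    rintro _ ⟨d, v, hv, rfl⟩
    change wreathAct σ _ ∈ semigroupAlgebra _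
    have e : wreathAct σ (AddMonoidAlgebra.single (d, v) (1 : ℂ)) =
        (actScalar σ v : ℂ) • AddMonoidAlgebra.single (d, permExponent σ v) (1 : ℂ) := by
      rw [wreathAct_single]; simp
    rw [e]
    refine Subalgebra.smul_mem _ (Algebra.subset_adjoin ?_) _
    exact ⟨d, _, permExponent_mem σ P hv, rfl⟩
  exact h hf

theorem weightVector_dot_permExponent (σ : WreathProduct k n) (a' : Fin m → ℤ)
    (v : Fin n × Fin m → ℤ) :
    weightVector n a' ⬝ᵥ permExponent σ v = weightVector n a' ⬝ᵥ v := by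
  simp only [dotProduct, weightVector, permExponent, Fintype.sum_prod_type]
  exact Equiv.sum_comp σ.right⁻¹ (fun i => ∑ j, a' j * v (i, j))

theorem wreathAct_mem_gradeBy (σ : WreathProduct k n) (a' : Fin m → ℤ) (dj : ℕ × ℤ)
    {f : MonomialRing (Fin n × Fin m)}
    (hf : f ∈ AddMonoidAlgebra.gradeBy ℂ
      (fun e : ℕ × (Fin n × Fin m → ℤ) => (e.1, weightVector n a' ⬝ᵥ e.2)) dj) :
    wreathAct σ f ∈ AddMonoidAlgebra.gradeBy ℂ
      (fun e : ℕ × (Fin n × Fin m → ℤ) => (e.1, weightVector n a' ⬝ᵥ e.2)) dj := by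
  rw [wreathAct, AddMonoidAlgebra.lift_apply]
  refine Submodule.sum_mem _ fun e he => Submodule.smul_mem _ _ ?_
  have h := hf e he
  rw [← h]
  intro x hx
  have hx' := Finset.mem_singleton.mp (Finsupp.support_single_subset hx)
  subst hx'
  exact Prod.ext rfl (weightVector_dot_permExponent σ a' e.2)

/-- The representation of `Z_k ≀ S_n` on `K[P^{×n}]_{d,j}`. -/
def bigradedPieceRep (k n : ℕ) {m : ℕ} (P : Set (Fin m → ℝ)) (a' : Fin m → ℤ) (d : ℕ) (j : ℤ) :
    Representation ℂ (WreathProduct k n) (bigradedPiece n P a' d j) :=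
  (wreathRep k n m).subrepresentation (bigradedPiece n P a' d j) fun σ f hf =>
    show wreathAct σ f ∈ bigradedPiece n P a' d j from
      ⟨wreathAct_mem_semigroupAlgebra σ P hf.1, wreathAct_mem_gradeBy σ a' (d, j) hf.2⟩

/-- The graded character `χ^{K[P^{×n}]_d} = ∑_j q^j tr(σ | K[P^{×n}]_{d,j})` of the component of
projective degree `d`, a Laurent polynomial in `q`. -/
def pieceCharacter {k n m : ℕ} (P : Set (Fin m → ℝ)) (a' : Fin m → ℤ) (d : ℕ)
    (σ : WreathProduct k n) : LaurentPolynomial ℂ :=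
  ∑ᶠ j : ℤ, (bigradedPieceRep k n P a' d j).character σ • LaurentPolynomial.T j

/-- The bigraded character `χ^{K[P^{×n}]} = ∑_{d,j} t^d q^j tr(σ | K[P^{×n}]_{d,j})`, a power
series in `t` whose coefficients are Laurent polynomials in `q`. -/
def bigradedCharacter {k n m : ℕ} (P : Set (Fin m → ℝ)) (a' : Fin m → ℤ)
    (σ : WreathProduct k n) : PowerSeries (LaurentPolynomial ℂ) :=
  PowerSeries.mk fun d =>
    ∑ᶠ j : ℤ, (bigradedPieceRep k n P a' d j).character σ • LaurentPolynomial.T j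

end Action

open Classical in
/-- The color rule `F_d = [v^n : v ∈ dP ∩ ℤ^m]` with value `p(v) = |v| = ∑_j v_j` and weight
`ρ(v) = q^{a'·v}`. -/
def polytopeColorRule (n : ℕ) {m : ℕ} (P : Set (Fin m → ℝ)) (a' : Fin m → ℤ) (d : ℕ) :
    ColorRule (Fin m → ℤ) (LaurentPolynomial ℂ) where
  mult v := if v ∈ dilationPoints P d then n else 0
  value v := ∑ j, v j
  weight v := LaurentPolynomial.T (a' ⬝ᵥ v)

end

/-!
The component `K[P^{×n}]_{d,j}` has a basis of monomials indexed by the tuples `f` of `n` lattice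
points of `dP` with `∑_i a'·f_i = j`: by convexity, products of the generating monomials are again
generating monomials (`mem_semigroupAlgebra`, `pieceBasis`). Since `σ` permutes these monomials up
to scalars, its trace is the sum of the scalars of the fixed monomials, and `f` is fixed exactly if
it is constant on the cycles of `σ`. This is the character of the color rule
(`character_polytopeColorRule`).

For the multiplicities, let `e` be the Young symmetrizer of `γ`. By complete reducibility an
intertwining map from the left ideal generated by `e` to a representation `V` is determined by the
image of `e`, which can be any vector of `eV`; so the multiplicity of `χ^γ` in `V` is the rank of
`e` on `V` (`Representation.card_inv_mul_sum_char_span_singleton`). No formula for `e²` is needed.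

On the monomial of a tuple `f`, regarded as a filling of the cells of `γ`, the factor of `e` that
comes from `Z_k^n` is `k^n` if every entry has a value congruent to the index of its block, and zero
otherwise. The remaining factor yields `youngVector f`, the result of antisymmetrizing along columns
and then symmetrizing along rows. The vectors of the semistandard fillings form a basis of the span
of all these vectors:

* they span, because Garnir relations and column permutations rewrite any vector
  (`youngVector_mem_span`); each rewriting step moves large entries to the right and so raises an
  integer measure, the energy along columns;
* they are linearly independent, because the coefficient of `S` in the vector of `T` vanishes unless
  `S = T` or `S` has smaller energy along rows (`linearIndependent_youngVector`).

Hence the rank of `e` on `K[P^{×n}]_{d,j}` is the number of semistandard fillings of combinatorial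
degree `j`.
-/

noncomputable section

/-! ### Sorting fillings along classes -/

section Sorting

variable {ι κ α : Type*} [Fintype ι] [LinearOrder α]

/-- The entries of `f` grow weakly along `pos` within every class of `cls`. -/
def WeaklySorted (cls : ι → κ) (pos : ι → ℕ) (f : ι → α) : Prop :=
  ∀ x y, cls x = cls y → pos x < pos y → f x ≤ f y

open Classical in
/-- The sum over all positions `c` of `pos c` times the rank of the entry `f c`, where the rank is
the number of smaller entries of `f`. Ranks depend only on the content of `f`, so this is a measure
of how far large entries of `f` sit from the origin which can be compared between rearrangements. -/
def energy (pos : ι → ℕ) (f : ι → α) : ℤ :=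
  ∑ c, ((Finset.univ.filter fun i => f i < f c).card : ℤ) * pos c

open Classical in
theorem card_filter_comp_perm (f : ι → α) (π : Equiv.Perm ι) (a : α) :
    (Finset.univ.filter fun i => (f ∘ π) i < a).card =
      (Finset.univ.filter fun i => f i < a).card := by
  refine Finset.card_bij (fun i _ => π i) (by simp) (fun i _ j _ h => π.injective h) ?_
  intro b hb
  exact ⟨π.symm b, by simpa using hb, by simp⟩

open Classical in
theorem card_filter_lt_of_lt (f : ι → α) {x y : ι} (h : f x < f y) :
    (Finset.univ.filter fun i => f i < f x).card < (Finset.univ.filter fun i => f i < f y).card := by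
  refine Finset.card_lt_card ⟨fun i hi => ?_, fun hs => ?_⟩
  · simp only [Finset.mem_filter, Finset.mem_univ, true_and] at hi ⊢
    exact hi.trans h
  · have := hs (show x ∈ _ by simpa using h)
    simp at this

open Classical in
theorem energy_comp_perm (pos : ι → ℕ) (f : ι → α) (π : Equiv.Perm ι) :
    energy pos (f ∘ π) =
      ∑ c, ((Finset.univ.filter fun i => f i < f (π c)).card : ℤ) * pos c := by
  unfold energy
  refine Finset.sum_congr rfl fun c _ => ?_
  rw [card_filter_comp_perm, Function.comp_apply]

open Classical in
theorem energy_comp_perm' (pos : ι → ℕ) (f : ι → α) (π : Equiv.Perm ι) :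
    energy pos (f ∘ π) =
      ∑ c, ((Finset.univ.filter fun i => f i < f c).card : ℤ) * pos (π.symm c) := by
  rw [energy_comp_perm]
  exact Fintype.sum_equiv π _ _ fun c => by simp

open Classical in
/-- Two rearrangements of the same entries within the classes coincide if both are sorted: for
every threshold `v`, the positions with entry at most `v` form initial segments of equal size. -/
theorem WeaklySorted.comp_perm_eq {cls : ι → κ} {pos : ι → ℕ}
    (inj : ∀ x y, cls x = cls y → pos x = pos y → x = y) {f : ι → α} (hf : WeaklySorted cls pos f)
    {π : Equiv.Perm ι} (hπ : ∀ i, cls (π i) = cls i) (hfπ : WeaklySorted cls pos (f ∘ π)) :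
    f ∘ π = f := by
  have key : ∀ c v, f c ≤ v ↔ f (π c) ≤ v := by
    intro c v
    let S := Finset.univ.filter fun x => cls x = cls c ∧ f x ≤ v
    let S' := Finset.univ.filter fun x => cls x = cls c ∧ f (π x) ≤ v
    have hcard : S'.card = S.card := by
      refine Finset.card_bij (fun i _ => π i) ?_ (fun i _ j _ h => π.injective h) ?_
      · intro i hi
        simpa [S, S', hπ] using hi
      · intro b hb
        refine ⟨π.symm b, ?_, by simp⟩
        have := hπ (π.symm b)
        simp only [Equiv.apply_symm_apply] at this
        simpa [S, S', ← this] using hb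
    have hSS : S = S' := by
      have hsub : S ⊆ S' ∨ S' ⊆ S := by
        by_contra hcon
        rw [not_or, Finset.not_subset, Finset.not_subset] at hcon
        obtain ⟨⟨x, hx, hx'⟩, y, hy, hy'⟩ := hcon
        simp only [S, S', Finset.mem_filter, Finset.mem_univ, true_and, not_and, not_le] at *
        have hxy : cls x = cls y := hx.1.trans hy.1.symm
        rcases lt_trichotomy (pos x) (pos y) with h | h | h
        · have := hfπ x y hxy h
          exact absurd ((this.trans hy.2).trans_lt (hx' hx.1)) (lt_irrefl _)
        · have := inj x y hxy h
          subst this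
          exact absurd (hx.2.trans_lt (hy' hy.1)) (lt_irrefl _)
        · have := hf y x hxy.symm h
          exact absurd ((this.trans hx.2).trans_lt (hy' hy.1)) (lt_irrefl _)
      rcases hsub with h | h
      · exact Finset.eq_of_subset_of_card_le h hcard.le
      · exact (Finset.eq_of_subset_of_card_le h hcard.ge).symm
    have : c ∈ S ↔ c ∈ S' := by rw [hSS]
    simpa [S, S'] using this
  funext c
  exact le_antisymm ((key c _).1 le_rfl) ((key c _).2 le_rfl)

open Classical in
/-- A rearrangement within the classes that maximizes the energy is sorted. -/
theorem weaklySorted_of_maximal {cls : ι → κ} {pos : ι → ℕ} {f : ι → α} {τ : Equiv.Perm ι}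
    (hτ : ∀ i, cls (τ i) = cls i)
    (hmax : ∀ τ' : Equiv.Perm ι, (∀ i, cls (τ' i) = cls i) →
      energy pos (f ∘ τ') ≤ energy pos (f ∘ τ)) :
    WeaklySorted cls pos (f ∘ τ) := by
  intro x y hxy hpos
  -- Exchanging the entries of an inversion raises the energy.
  by_contra hlt
  rw [not_le] at hlt
  have hswap : ∀ i, cls (Equiv.swap x y i) = cls i := by
    intro i
    rw [Equiv.swap_apply_def]
    split_ifs with h1 h2
    · rw [h1, hxy]
    · rw [h2, hxy]
    · rfl
  have h := hmax (τ * Equiv.swap x y) (fun i => by rw [Equiv.Perm.mul_apply, hτ, hswap])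
  have e : f ∘ ⇑(τ * Equiv.swap x y) = (f ∘ τ) ∘ Equiv.swap x y := rfl
  rw [e, energy_comp_perm', energy, ← sub_nonpos, ← Finset.sum_sub_distrib] at h
  have hne : x ≠ y := fun h => by simp [h] at hpos
  rw [Finset.sum_eq_add x y hne (fun c _ hc => by
    rw [Equiv.symm_swap, Equiv.swap_apply_of_ne_of_ne hc.1 hc.2, sub_self]) (by simp) (by simp)] at h
  rw [Equiv.symm_swap, Equiv.swap_apply_left, Equiv.swap_apply_right] at h
  have h1 := card_filter_lt_of_lt (f ∘ τ) hlt
  zify at h1 hpos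
  nlinarith

theorem exists_maximal_energy (cls : ι → κ) (pos : ι → ℕ) (f : ι → α) :
    ∃ τ : Equiv.Perm ι, (∀ i, cls (τ i) = cls i) ∧
      ∀ τ' : Equiv.Perm ι, (∀ i, cls (τ' i) = cls i) →
        energy pos (f ∘ τ') ≤ energy pos (f ∘ τ) := by
  classical
  obtain ⟨τ, hτ, hmax⟩ := Finset.exists_max_image
    (Finset.univ.filter fun τ : Equiv.Perm ι => ∀ i, cls (τ i) = cls i)
    (fun τ => energy pos (f ∘ τ)) ⟨1, by simp⟩
  exact ⟨τ, by simpa using hτ, fun τ' h => hmax τ' (by simpa using h)⟩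

/-- The strictly sorted rearrangement is the unique one of maximal energy. -/
theorem energy_comp_le {cls : ι → κ} {pos : ι → ℕ}
    (inj : ∀ x y, cls x = cls y → pos x = pos y → x = y) {f : ι → α}
    (hf : ∀ x y, cls x = cls y → pos x < pos y → f x < f y)
    {τ : Equiv.Perm ι} (hτ : ∀ i, cls (τ i) = cls i) :
    energy pos (f ∘ τ) ≤ energy pos f ∧ (energy pos (f ∘ τ) = energy pos f → τ = 1) := by
  have hw : WeaklySorted cls pos f := fun x y h h' => (hf x y h h').le
  obtain ⟨τ₀, hτ₀, hmax⟩ := exists_maximal_energy cls pos f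
  have h0 := hw.comp_perm_eq inj hτ₀ (weaklySorted_of_maximal hτ₀ hmax)
  rw [h0] at hmax
  refine ⟨hmax τ hτ, fun heq => ?_⟩
  have h1 := hw.comp_perm_eq inj hτ (weaklySorted_of_maximal hτ (by rwa [heq]))
  ext1 x
  by_contra hne
  have hx := congrFun h1 x
  rw [Function.comp_apply] at hx
  rcases lt_trichotomy (pos (τ x)) (pos x) with h | h | h
  · exact (hf _ _ (hτ x) h).ne hx
  · exact hne (inj _ _ (hτ x) h)
  · exact (hf _ _ (hτ x).symm h).ne hx.symm

end Sorting

/-! ### Young symmetrizers acting on fillings -/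

namespace MultiPartition

variable {k n : ℕ} (γ : MultiPartition k n)

theorem mem_cells (c : Fin n) : (γ.row c, γ.col c) ∈ (γ.shape (γ.block c)).cells :=
  (γ.numbering.symm c).2.2

theorem numbering_spec (r : Fin k) (x : {c : ℕ × ℕ // c ∈ (γ.shape r).cells}) :
    γ.block (γ.numbering ⟨r, x⟩) = r ∧ γ.row (γ.numbering ⟨r, x⟩) = x.1.1 ∧
      γ.col (γ.numbering ⟨r, x⟩) = x.1.2 := by
  unfold block row col
  rw [Equiv.symm_apply_apply]
  exact ⟨rfl, rfl, rfl⟩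

theorem exists_letter {r : Fin k} {i j : ℕ} (h : (i, j) ∈ (γ.shape r).cells) :
    ∃ c, γ.block c = r ∧ γ.row c = i ∧ γ.col c = j :=
  ⟨_, γ.numbering_spec r ⟨(i, j), h⟩⟩

theorem letter_ext {c d : Fin n} (hb : γ.block c = γ.block d) (hr : γ.row c = γ.row d)
    (hc : γ.col c = γ.col d) : c = d := by
  apply γ.numbering.symm.injective
  unfold block row col at *
  generalize γ.numbering.symm c = a at *
  generalize γ.numbering.symm d = b at *
  obtain ⟨r, ⟨⟨i, j⟩, h⟩⟩ := a
  obtain ⟨r', ⟨⟨i', j'⟩, h'⟩⟩ := b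
  simp only at hb hr hc
  subst hb hr hc
  rfl

theorem mem_rowGroup {π : Equiv.Perm (Fin n)} :
    π ∈ γ.rowGroup ↔ ∀ i, γ.block (π i) = γ.block i ∧ γ.row (π i) = γ.row i := by
  simp [rowGroup]

theorem mem_colGroup {π : Equiv.Perm (Fin n)} :
    π ∈ γ.colGroup ↔ ∀ i, γ.block (π i) = γ.block i ∧ γ.col (π i) = γ.col i := by
  simp [colGroup]

theorem mul_mem_rowGroup {π σ : Equiv.Perm (Fin n)} (hπ : π ∈ γ.rowGroup) (hσ : σ ∈ γ.rowGroup) :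
    π * σ ∈ γ.rowGroup := by
  rw [mem_rowGroup] at *
  exact fun i => ⟨(hπ _).1.trans (hσ i).1, (hπ _).2.trans (hσ i).2⟩

theorem mul_mem_colGroup {π σ : Equiv.Perm (Fin n)} (hπ : π ∈ γ.colGroup) (hσ : σ ∈ γ.colGroup) :
    π * σ ∈ γ.colGroup := by
  rw [mem_colGroup] at *
  exact fun i => ⟨(hπ _).1.trans (hσ i).1, (hπ _).2.trans (hσ i).2⟩

theorem inv_mem_rowGroup {π : Equiv.Perm (Fin n)} (hπ : π ∈ γ.rowGroup) : π⁻¹ ∈ γ.rowGroup := by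
  rw [mem_rowGroup] at *
  intro i
  have := hπ (π⁻¹ i)
  rw [show π (π⁻¹ i) = i from π.apply_symm_apply i] at this
  exact ⟨this.1.symm, this.2.symm⟩

theorem inv_mem_colGroup {π : Equiv.Perm (Fin n)} (hπ : π ∈ γ.colGroup) : π⁻¹ ∈ γ.colGroup := by
  rw [mem_colGroup] at *
  intro i
  have := hπ (π⁻¹ i)
  rw [show π (π⁻¹ i) = i from π.apply_symm_apply i] at this
  exact ⟨this.1.symm, this.2.symm⟩

theorem swap_mem_rowGroup {x y : Fin n} (hb : γ.block x = γ.block y) (hr : γ.row x = γ.row y) :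
    Equiv.swap x y ∈ γ.rowGroup := by
  rw [mem_rowGroup]
  intro i
  rw [Equiv.swap_apply_def]
  split_ifs with h1 h2 <;> simp_all

theorem swap_mem_colGroup {x y : Fin n} (hb : γ.block x = γ.block y) (hc : γ.col x = γ.col y) :
    Equiv.swap x y ∈ γ.colGroup := by
  rw [mem_colGroup]
  intro i
  rw [Equiv.swap_apply_def]
  split_ifs with h1 h2 <;> simp_all

variable {α : Type*}

/-- The result of letting the product of the row sum and the signed column sum act on the filling
`f` of the cells of `γ`. The action is by precomposition; since both stabilizers are groups, the
inverses that turn this into a left action may be left out. -/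
def youngVector (f : Fin n → α) : (Fin n → α) →₀ ℂ :=
  ∑ π ∈ γ.rowGroup, ∑ τ ∈ γ.colGroup,
    ((Equiv.Perm.sign τ : ℤ) : ℂ) • Finsupp.single (f ∘ τ ∘ π) 1

theorem youngVector_apply [DecidableEq α] (T S : Fin n → α) :
    γ.youngVector T S = ∑ π ∈ γ.rowGroup, ∑ τ ∈ γ.colGroup,
      if T ∘ τ ∘ π = S then ((Equiv.Perm.sign τ : ℤ) : ℂ) else 0 := by
  simp [youngVector, Finsupp.finsetSum_apply, Finsupp.single_apply]

theorem sign_mul_self (σ : Equiv.Perm (Fin n)) :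
    ((Equiv.Perm.sign σ : ℤ) : ℂ) * ((Equiv.Perm.sign σ : ℤ) : ℂ) = 1 := by
  rcases Int.units_eq_one_or (Equiv.Perm.sign σ) with h | h <;> simp [h]

theorem youngVector_comp_colGroup (f : Fin n → α) {σ : Equiv.Perm (Fin n)}
    (hσ : σ ∈ γ.colGroup) :
    γ.youngVector (f ∘ σ) = ((Equiv.Perm.sign σ : ℤ) : ℂ) • γ.youngVector f := by
  unfold youngVector
  rw [Finset.smul_sum]
  refine Finset.sum_congr rfl fun π _ => ?_
  rw [Finset.smul_sum]
  refine Finset.sum_equiv (Equiv.mulLeft σ) (fun τ => ⟨fun h => γ.mul_mem_colGroup hσ h, fun h => ?_⟩)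
    (fun τ _ => ?_)
  · have := γ.mul_mem_colGroup (γ.inv_mem_colGroup hσ) h
    simpa using this
  · rw [smul_smul, Equiv.coe_mulLeft, Equiv.Perm.sign_mul, Units.val_mul, Int.cast_mul, ← mul_assoc,
      sign_mul_self, one_mul]
    rfl

/-- A filling with a repeated entry in a column is killed by the signed column sum. -/
theorem youngVector_eq_zero_of_repeat {f : Fin n → α} {x y : Fin n} (hxy : x ≠ y)
    (hb : γ.block x = γ.block y) (hc : γ.col x = γ.col y) (hf : f x = f y) :
    γ.youngVector f = 0 := by
  have h := γ.youngVector_comp_colGroup f (γ.swap_mem_colGroup hb hc)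
  have e : f ∘ Equiv.swap x y = f := by
    funext i
    rw [Function.comp_apply, Equiv.swap_apply_def]
    split_ifs with h1 h2 <;> simp_all
  rw [e, Equiv.Perm.sign_swap hxy] at h
  simpa [self_eq_neg] using h

open Classical in
/-- The permutations of the letters which move only elements of `E`. -/
def permsOn (E : Finset (Fin n)) : Finset (Equiv.Perm (Fin n)) :=
  Finset.univ.filter fun κ => ∀ i, i ∉ E → κ i = i

theorem mem_permsOn {E : Finset (Fin n)} {κ : Equiv.Perm (Fin n)} :
    κ ∈ permsOn E ↔ ∀ i, i ∉ E → κ i = i := by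
  simp [permsOn]

theorem permsOn_apply_mem {E : Finset (Fin n)} {κ : Equiv.Perm (Fin n)} (hκ : κ ∈ permsOn E)
    {i : Fin n} (hi : i ∈ E) : κ i ∈ E := by
  by_contra h
  have := κ.injective (mem_permsOn.1 hκ _ h)
  rw [this] at h
  exact h hi

/-- The Garnir relation: if every column permutation carries two letters of a common row into
`E`, then antisymmetrizing over `E` is annihilated by the Young symmetrizer. The transposition of
the two letters is absorbed by the row sum and changes the sign of the antisymmetrizer. -/
theorem sum_permsOn_youngVector (f : Fin n → α) {E : Finset (Fin n)}
    (hE : ∀ τ ∈ γ.colGroup, ∃ x y, x ≠ y ∧ τ x ∈ E ∧ τ y ∈ E ∧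
      γ.block x = γ.block y ∧ γ.row x = γ.row y) :
    ∑ κ ∈ permsOn E, ((Equiv.Perm.sign κ : ℤ) : ℂ) • γ.youngVector (f ∘ κ) = 0 := by
  classical
  have e : ∑ κ ∈ permsOn E, ((Equiv.Perm.sign κ : ℤ) : ℂ) • γ.youngVector (f ∘ κ) =
      ∑ τ ∈ γ.colGroup, ((Equiv.Perm.sign τ : ℤ) : ℂ) • ∑ p ∈ permsOn E ×ˢ γ.rowGroup,
        ((Equiv.Perm.sign p.1 : ℤ) : ℂ) • Finsupp.single (f ∘ p.1 ∘ τ ∘ p.2) (1 : ℂ) := by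
    simp only [youngVector, Finset.smul_sum, Finset.sum_product]
    rw [Finset.sum_comm]
    conv_rhs => rw [Finset.sum_comm]; enter [2, κ]; rw [Finset.sum_comm]
    rw [Finset.sum_comm]
    refine Finset.sum_congr rfl fun κ _ => Finset.sum_congr rfl fun π _ =>
      Finset.sum_congr rfl fun τ _ => ?_
    rw [smul_comm]
    rfl
  rw [e]
  refine Finset.sum_eq_zero fun τ hτ => ?_
  obtain ⟨x, y, hxy, hx, hy, hb, hr⟩ := hE τ hτ
  have hne : τ x ≠ τ y := fun h => hxy (τ.injective h)
  refine smul_eq_zero_of_right _ (Finset.sum_involution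
    (fun p _ => (p.1 * Equiv.swap (τ x) (τ y), Equiv.swap x y * p.2)) ?_ ?_ ?_ ?_)
  · rintro ⟨κ, π⟩ _
    have h : (κ * Equiv.swap (τ x) (τ y)) * τ * (Equiv.swap x y * π) = κ * τ * π := by
      rw [mul_assoc κ, ← Equiv.mul_swap_eq_swap_mul]
      simp [mul_assoc]
    have h' : f ∘ ⇑(κ * Equiv.swap (τ x) (τ y)) ∘ τ ∘ ⇑(Equiv.swap x y * π) = f ∘ κ ∘ τ ∘ π := by
      have := congrArg (fun g : Equiv.Perm (Fin n) => f ∘ g) h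
      exact this
    simp only [h', Equiv.Perm.sign_mul, Equiv.Perm.sign_swap hne]
    simp
  · rintro ⟨κ, π⟩ _ _ h
    have := congrArg Prod.fst h
    simp only [mul_eq_left] at this
    exact hne (Equiv.swap_eq_one_iff.1 this)
  · rintro ⟨κ, π⟩ h
    rw [Finset.mem_product] at h ⊢
    refine ⟨mem_permsOn.2 fun i hi => ?_, γ.mul_mem_rowGroup (γ.swap_mem_rowGroup hb hr) h.2⟩
    rw [Equiv.Perm.mul_apply, Equiv.swap_apply_of_ne_of_ne, mem_permsOn.1 h.1 i hi]
    · rintro rfl; exact hi hx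
    · rintro rfl; exact hi hy
  · rintro ⟨κ, π⟩ _
    simp [mul_assoc]

open Classical in
/-- The Garnir set of two letters `x`, `y` of a common row: the letters below or equal to `x` in
its column, and those above or equal to `y` in the column of `y`. -/
def garnirSet (x y : Fin n) : Finset (Fin n) :=
  Finset.univ.filter fun c => γ.block c = γ.block x ∧
    ((γ.col c = γ.col x ∧ γ.row x ≤ γ.row c) ∨ (γ.col c = γ.col y ∧ γ.row c ≤ γ.row x))

theorem mem_garnirSet {x y c : Fin n} : c ∈ γ.garnirSet x y ↔ γ.block c = γ.block x ∧
    ((γ.col c = γ.col x ∧ γ.row x ≤ γ.row c) ∨ (γ.col c = γ.col y ∧ γ.row c ≤ γ.row x)) := by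
  simp [garnirSet]

/-- The Garnir set has one letter more than the left one of its two columns has cells, whence two
letters share a row after any column permutation. -/
theorem exists_same_row_garnirSet {x y : Fin n} (hb : γ.block x = γ.block y)
    (hr : γ.row x = γ.row y) (hc : γ.col x < γ.col y) {τ : Equiv.Perm (Fin n)}
    (hτ : τ ∈ γ.colGroup) :
    ∃ u v, u ≠ v ∧ τ u ∈ γ.garnirSet x y ∧ τ v ∈ γ.garnirSet x y ∧
      γ.block u = γ.block v ∧ γ.row u = γ.row v := by
  classical
  let ℓ := (γ.shape (γ.block x)).colLen (γ.col x)
  have hxmem := γ.mem_cells x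
  have hymem := γ.mem_cells y
  rw [← hb, ← hr] at hymem
  have hxl : γ.row x < ℓ := YoungDiagram.mem_iff_lt_colLen.1 hxmem
  -- List the Garnir set by `r ≤ ℓ`: up to the row of `x` in the right column, then in the left one.
  have hcell : ∀ r : ℕ, r < ℓ + 1 → ∃ c ∈ γ.garnirSet x y,
      (r ≤ γ.row x → γ.row c = r ∧ γ.col c = γ.col y) ∧
      (γ.row x < r → γ.row c + 1 = r ∧ γ.col c = γ.col x) := by
    intro r hrl
    by_cases h : r ≤ γ.row x
    · obtain ⟨c, h1, h2, h3⟩ := γ.exists_letter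
        ((γ.shape (γ.block x)).up_left_mem h le_rfl hymem)
      exact ⟨c, γ.mem_garnirSet.2 ⟨h1, Or.inr ⟨h3, h2 ▸ h⟩⟩, fun _ => ⟨h2, h3⟩, fun h' => by omega⟩
    · obtain ⟨c, h1, h2, h3⟩ := γ.exists_letter (r := γ.block x) (i := r - 1) (j := γ.col x)
        (YoungDiagram.mem_iff_lt_colLen.2 (by omega))
      exact ⟨c, γ.mem_garnirSet.2 ⟨h1, Or.inl ⟨h3, by omega⟩⟩, fun h' => by omega,
        fun _ => ⟨by omega, h3⟩⟩
  have : Nonempty (Fin n) := ⟨x⟩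
  choose! g hg hg1 hg2 using hcell
  have hτ' := γ.mem_colGroup.1 (γ.inv_mem_colGroup hτ)
  have hblock : ∀ r, r < ℓ + 1 → γ.block (τ⁻¹ (g r)) = γ.block x := fun r h =>
    (hτ' _).1.trans (γ.mem_garnirSet.1 (hg r h)).1
  have hmaps : ∀ r ∈ Finset.range (ℓ + 1), γ.row (τ⁻¹ (g r)) ∈ Finset.range ℓ := by
    intro r hr
    rw [Finset.mem_range] at hr ⊢
    have hm := γ.mem_cells (τ⁻¹ (g r))
    rw [hblock r hr, (hτ' _).2] at hm
    refine YoungDiagram.mem_iff_lt_colLen.1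
      ((γ.shape (γ.block x)).up_left_mem le_rfl ?_ hm)
    rcases (γ.mem_garnirSet.1 (hg r hr)).2 with h | h <;> omega
  obtain ⟨r, hr, s, hs, hrs, heq⟩ := Finset.exists_ne_map_eq_of_card_lt_of_maps_to
    (by simp : (Finset.range ℓ).card < (Finset.range (ℓ + 1)).card) hmaps
  rw [Finset.mem_range] at hr hs
  refine ⟨τ⁻¹ (g r), τ⁻¹ (g s), fun h => hrs ?_, by simpa using hg r hr, by simpa using hg s hs,
    (hblock r hr).trans (hblock s hs).symm, heq⟩
  have h := τ⁻¹.injective h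
  have r1 := hg1 r hr
  have r2 := hg2 r hr
  have s1 := hg1 s hs
  have s2 := hg2 s hs
  rw [h] at r1 r2
  omega

end MultiPartition

/-! ### The semistandard basis theorem -/

namespace MultiPartition

variable {k n : ℕ} (γ : MultiPartition k n) {α : Type*} [LinearOrder α]

/-- The filling `f` of the cells of `γ` is semistandard in every block: rows are weakly increasing
and columns are strictly increasing. -/
structure SemistandardFilling (f : Fin n → α) : Prop where
  row_weak : ∀ x y, γ.block x = γ.block y → γ.row x = γ.row y → γ.col x < γ.col y → f x ≤ f y
  col_strict : ∀ x y, γ.block x = γ.block y → γ.col x = γ.col y → γ.row x < γ.row y → f x < f y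

open Classical in
/-- An exchange which moves a letter of the right part of a Garnir set into the left part raises
the energy along columns, because all entries of the left part exceed those of the right part. -/
theorem energy_lt_of_exchange {f : Fin n → α} {x y : Fin n} (hb : γ.block x = γ.block y)
    (hr : γ.row x = γ.row y) (hc : γ.col x < γ.col y)
    (hf : ∀ u v, γ.block u = γ.block v → γ.col u = γ.col v → γ.row u < γ.row v → f u < f v)
    (hyx : f y < f x) {κ : Equiv.Perm (Fin n)} (hκ : κ ∈ permsOn (γ.garnirSet x y))
    {a : Fin n} (ha : a ∈ γ.garnirSet x y) (hac : γ.col a = γ.col x)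
    (hκa : γ.col (κ a) ≠ γ.col x) :
    energy γ.col f < energy γ.col (f ∘ κ) := by
  have hleft : ∀ c ∈ γ.garnirSet x y, γ.col c = γ.col x → f x ≤ f c := by
    intro c hcE hcx
    rw [mem_garnirSet] at hcE
    rcases hcE.2 with h | h
    · rcases h.2.lt_or_eq with h' | h'
      · exact (hf _ _ hcE.1.symm hcx.symm h').le
      · rw [γ.letter_ext hcE.1 h'.symm hcx]
    · omega
  have hright : ∀ c ∈ γ.garnirSet x y, γ.col c ≠ γ.col x → γ.col c = γ.col y ∧ f c < f x := by
    intro c hcE hcx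
    rw [mem_garnirSet] at hcE
    rcases hcE.2 with h | h
    · exact absurd h.1 hcx
    · refine ⟨h.1, lt_of_le_of_lt ?_ hyx⟩
      rcases (hr ▸ h.2).lt_or_eq with h' | h'
      · exact (hf _ _ (hcE.1.trans hb) h.1 h').le
      · rw [γ.letter_ext (hcE.1.trans hb) h' h.1]
  let rk : Fin n → ℤ := fun c => ((Finset.univ.filter fun i => f i < f c).card : ℤ)
  have hrk : ∀ c d, f c < f d → rk c < rk d := fun c d h => by
    simpa only [rk, Nat.cast_lt] using card_filter_lt_of_lt f h
  have hrk' : ∀ c d, f c ≤ f d → rk c ≤ rk d := fun c d h => by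
    rcases h.lt_or_eq with h | h
    · exact (hrk c d h).le
    · exact le_of_eq (by simp only [rk, h])
  have hsymm : ∀ c ∈ γ.garnirSet x y, κ.symm c ∈ γ.garnirSet x y := by
    intro c hcE
    by_contra h
    have := mem_permsOn.1 hκ _ h
    rw [Equiv.apply_symm_apply] at this
    exact h (this ▸ hcE)
  have hsum : ∑ c, (γ.col (κ.symm c) : ℤ) = ∑ c, (γ.col c : ℤ) :=
    Equiv.sum_comp κ.symm fun c => (γ.col c : ℤ)
  -- Subtracting the rank of `f x` from all ranks changes nothing and makes every term nonnegative.
  have hdiff : energy γ.col (f ∘ κ) - energy γ.col f =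
      ∑ c, (rk c - rk x) * ((γ.col (κ.symm c) : ℤ) - γ.col c) := by
    have e : ∀ c, (rk c - rk x) * ((γ.col (κ.symm c) : ℤ) - γ.col c) =
        (rk c * γ.col (κ.symm c) - rk c * γ.col c) -
          rk x * ((γ.col (κ.symm c) : ℤ) - γ.col c) := fun c => by ring
    rw [Finset.sum_congr rfl fun c _ => e c, Finset.sum_sub_distrib, ← Finset.mul_sum,
      Finset.sum_sub_distrib (f := fun c => (γ.col (κ.symm c) : ℤ)), hsum, sub_self, mul_zero,
      sub_zero, Finset.sum_sub_distrib, energy_comp_perm']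
    rfl
  rw [← sub_pos, hdiff]
  refine Finset.sum_pos' (fun c _ => ?_) ⟨κ a, Finset.mem_univ _, ?_⟩
  · by_cases hcE : c ∈ γ.garnirSet x y
    · have hs := hsymm c hcE
      by_cases hcx : γ.col c = γ.col x
      · have h1 := hrk' _ _ (hleft c hcE hcx)
        refine mul_nonneg (sub_nonneg.2 h1) ?_
        by_cases hsx : γ.col (κ.symm c) = γ.col x
        · rw [hsx, hcx, sub_self]
        · rw [(hright _ hs hsx).1, hcx]
          omega
      · have h1 := hrk _ _ (hright c hcE hcx).2
        refine mul_nonneg_of_nonpos_of_nonpos (by omega) ?_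
        rw [(hright c hcE hcx).1]
        by_cases hsx : γ.col (κ.symm c) = γ.col x
        · rw [hsx]
          omega
        · rw [(hright _ hs hsx).1, sub_self]
    · have h : κ.symm c = c := by
        rw [Equiv.symm_apply_eq]
        exact (mem_permsOn.1 hκ c hcE).symm
      rw [h, sub_self, mul_zero]
  · have h := hright _ (permsOn_apply_mem hκ ha) hκa
    have h1 := hrk _ _ h.2
    rw [Equiv.symm_apply_apply, h.1, hac]
    exact mul_pos_of_neg_of_neg (by omega) (by omega)

/-- A permutation of a Garnir set which preserves its left part is a column permutation. -/
theorem mem_colGroup_of_preserves {x y : Fin n} {κ : Equiv.Perm (Fin n)}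
    (hκ : κ ∈ permsOn (γ.garnirSet x y))
    (h : ∀ a ∈ γ.garnirSet x y, γ.col a = γ.col x → γ.col (κ a) = γ.col x) :
    κ ∈ γ.colGroup := by
  classical
  let A := (γ.garnirSet x y).filter fun c => γ.col c = γ.col x
  have hA : A.image κ = A := by
    refine Finset.eq_of_subset_of_card_le ?_ (Finset.card_image_of_injective _ κ.injective).ge
    intro b hb
    obtain ⟨a, ha, rfl⟩ := Finset.mem_image.1 hb
    rw [Finset.mem_filter] at ha ⊢
    exact ⟨permsOn_apply_mem hκ ha.1, h a ha.1 ha.2⟩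
  rw [mem_colGroup]
  intro c
  by_cases hc : c ∈ γ.garnirSet x y
  · have hκc := permsOn_apply_mem hκ hc
    have hcE := γ.mem_garnirSet.1 hc
    have hκE := γ.mem_garnirSet.1 hκc
    refine ⟨hκE.1.trans hcE.1.symm, ?_⟩
    by_cases hcx : γ.col c = γ.col x
    · rw [h c hc hcx, hcx]
    · have hκx : γ.col (κ c) ≠ γ.col x := by
        intro hk
        have : κ c ∈ A.image κ := by
          rw [hA, Finset.mem_filter]
          exact ⟨hκc, hk⟩
        obtain ⟨a, ha, hac⟩ := Finset.mem_image.1 this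
        rw [κ.injective hac] at ha
        exact hcx (Finset.mem_filter.1 ha).2
      rcases hcE.2 with h1 | h1
      · exact absurd h1.1 hcx
      · rcases hκE.2 with h2 | h2
        · exact absurd h2.1 hκx
        · rw [h1.1, h2.1]
  · rw [mem_permsOn.1 hκ c hc]
    exact ⟨rfl, rfl⟩

/-- Straightening: the vector of any filling is a combination of vectors of semistandard
rearrangements, where entries stay within their block. The induction is on the energy along
columns, which a Garnir relation raises and a column permutation preserves. -/
theorem youngVector_mem_span (f : Fin n → α) :
    γ.youngVector f ∈ Submodule.span ℂ (γ.youngVector '' {T | γ.SemistandardFilling T ∧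
      ∃ π : Equiv.Perm (Fin n), (∀ i, γ.block (π i) = γ.block i) ∧ T = f ∘ π}) := by
  classical
  set S := Submodule.span ℂ (γ.youngVector '' {T | γ.SemistandardFilling T ∧
      ∃ π : Equiv.Perm (Fin n), (∀ i, γ.block (π i) = γ.block i) ∧ T = f ∘ π}) with hS
  by_contra hcon
  obtain ⟨π, hπ, hmax⟩ := Finset.exists_max_image
    (Finset.univ.filter fun π : Equiv.Perm (Fin n) =>
      (∀ i, γ.block (π i) = γ.block i) ∧ γ.youngVector (f ∘ π) ∉ S)
    (fun π => energy γ.col (f ∘ π)) ⟨1, by simpa using hcon⟩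
  simp only [Finset.mem_filter, Finset.mem_univ, true_and] at hπ hmax
  have hinj : ∀ x y, γ.block x = γ.block y → γ.col x = γ.col y → (f ∘ π) x = (f ∘ π) y → x = y := by
    intro x y hb hc hxy
    by_contra hne
    apply hπ.2
    rw [γ.youngVector_eq_zero_of_repeat hne hb hc hxy]
    exact zero_mem _
  -- Sort the columns.
  obtain ⟨τ, hτ, hτmax⟩ := exists_maximal_energy (fun c => (γ.block c, γ.col c)) γ.row (f ∘ π)
  have hτsort := weaklySorted_of_maximal (cls := fun c => (γ.block c, γ.col c)) hτ hτmax
  simp only [Prod.mk.injEq] at hτ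
  have hτC : τ ∈ γ.colGroup := γ.mem_colGroup.2 hτ
  set g := (f ∘ π) ∘ τ with hg
  have hgstrict : ∀ u v, γ.block u = γ.block v → γ.col u = γ.col v → γ.row u < γ.row v →
      g u < g v := by
    intro u v hb hc hr
    refine lt_of_le_of_ne (hτsort u v (Prod.ext hb hc) hr) fun h => ?_
    have := hinj (τ u) (τ v) (by rw [(hτ u).1, (hτ v).1, hb]) (by rw [(hτ u).2, (hτ v).2, hc]) h
    rw [τ.injective this] at hr
    exact lt_irrefl _ hr
  have hgS : γ.youngVector g ∉ S := by
    intro h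
    apply hπ.2
    rw [hg, γ.youngVector_comp_colGroup _ hτC] at h
    have := S.smul_mem ((Equiv.Perm.sign τ : ℤ) : ℂ) h
    rwa [smul_smul, sign_mul_self, one_smul] at this
  have hgmax : ∀ κ : Equiv.Perm (Fin n), (∀ i, γ.block (κ i) = γ.block i) →
      energy γ.col g < energy γ.col (g ∘ κ) → γ.youngVector (g ∘ κ) ∈ S := by
    intro κ hκ hlt
    by_contra h
    have e : energy γ.col g = energy γ.col (f ∘ π) := by
      rw [hg, energy_comp_perm]
      exact (Fintype.sum_equiv τ _ _ fun c => by rw [(hτ c).2])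
    have := hmax (π * τ * κ) ⟨fun i => by
      rw [Equiv.Perm.mul_apply, Equiv.Perm.mul_apply, hπ.1, (hτ _).1, hκ], h⟩
    rw [← e] at this
    exact absurd hlt (not_lt.2 this)
  -- Rows of `g` cannot all be weakly increasing, so there is a Garnir relation to apply.
  have hviol : ∃ x y, γ.block x = γ.block y ∧ γ.row x = γ.row y ∧ γ.col x < γ.col y ∧ g y < g x := by
    by_contra h
    push Not at h
    refine hgS (Submodule.subset_span ⟨g, ⟨⟨h, hgstrict⟩, π * τ, fun i => ?_, rfl⟩, rfl⟩)
    rw [Equiv.Perm.mul_apply, hπ.1, (hτ _).1]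
  obtain ⟨x, y, hb, hr, hc, hyx⟩ := hviol
  have hgar := γ.sum_permsOn_youngVector g (E := γ.garnirSet x y)
    fun τ hτ => γ.exists_same_row_garnirSet hb hr hc hτ
  rw [← Finset.sum_filter_add_sum_filter_not _ fun κ => κ ∈ γ.colGroup] at hgar
  -- Column permutations of the Garnir set reproduce `g`; all other terms have higher energy.
  have hgood : ∑ κ ∈ (permsOn (γ.garnirSet x y)).filter (fun κ => κ ∈ γ.colGroup),
      ((Equiv.Perm.sign κ : ℤ) : ℂ) • γ.youngVector (g ∘ κ) =
      (((permsOn (γ.garnirSet x y)).filter (fun κ => κ ∈ γ.colGroup)).card : ℂ) •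
        γ.youngVector g := by
    rw [Finset.sum_congr rfl fun κ hκ => by
      rw [γ.youngVector_comp_colGroup g (Finset.mem_filter.1 hκ).2, smul_smul, sign_mul_self,
        one_smul]]
    rw [Finset.sum_const, Nat.cast_smul_eq_nsmul]
  have hbad : ∑ κ ∈ (permsOn (γ.garnirSet x y)).filter (fun κ => κ ∉ γ.colGroup),
      ((Equiv.Perm.sign κ : ℤ) : ℂ) • γ.youngVector (g ∘ κ) ∈ S := by
    refine S.sum_mem fun κ hκ => S.smul_mem _ ?_
    rw [Finset.mem_filter] at hκ
    have hex : ∃ a ∈ γ.garnirSet x y, γ.col a = γ.col x ∧ γ.col (κ a) ≠ γ.col x := by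
      by_contra h
      push Not at h
      exact hκ.2 (γ.mem_colGroup_of_preserves hκ.1 h)
    obtain ⟨a, ha, hac, hκa⟩ := hex
    refine hgmax κ (fun i => ?_) (γ.energy_lt_of_exchange hb hr hc hgstrict hyx hκ.1 ha hac hκa)
    by_cases hi : i ∈ γ.garnirSet x y
    · rw [(γ.mem_garnirSet.1 hi).1, (γ.mem_garnirSet.1 (permsOn_apply_mem hκ.1 hi)).1]
    · rw [mem_permsOn.1 hκ.1 i hi]
  rw [hgood] at hgar
  have hmem : (((permsOn (γ.garnirSet x y)).filter (fun κ => κ ∈ γ.colGroup)).card : ℂ) •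
        γ.youngVector g ∈ S := by
    rw [eq_neg_of_add_eq_zero_left hgar]
    exact S.neg_mem hbad
  refine hgS ((S.smul_mem_iff ?_).1 hmem)
  rw [Nat.cast_ne_zero, ← Nat.pos_iff_ne_zero, Finset.card_pos]
  exact ⟨1, by simp [mem_permsOn, mem_colGroup]⟩

theorem energy_row_comp (f : Fin n → α) {π : Equiv.Perm (Fin n)} (hπ : π ∈ γ.rowGroup) :
    energy γ.row (f ∘ π) = energy γ.row f := by
  classical
  rw [energy_comp_perm]
  exact Fintype.sum_equiv π _ _ fun c => by rw [(γ.mem_rowGroup.1 hπ c).2]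

/-- The terms of the vector of a semistandard filling `T` have at most the energy of `T` along rows,
and those of equal energy come from the trivial column permutation. -/
theorem SemistandardFilling.energy_term_le {γ : MultiPartition k n} {T : Fin n → α}
    (hT : γ.SemistandardFilling T) {π τ : Equiv.Perm (Fin n)} (hπ : π ∈ γ.rowGroup)
    (hτ : τ ∈ γ.colGroup) :
    energy γ.row (T ∘ τ ∘ π) ≤ energy γ.row T ∧
      (energy γ.row (T ∘ τ ∘ π) = energy γ.row T → τ = 1) := by
  rw [← Function.comp_assoc, γ.energy_row_comp _ hπ]
  refine energy_comp_le (cls := fun c => (γ.block c, γ.col c)) ?_ ?_ ?_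
  · intro x y h h'
    exact γ.letter_ext (Prod.ext_iff.1 h).1 h' (Prod.ext_iff.1 h).2
  · intro x y h h'
    exact hT.col_strict x y (Prod.ext_iff.1 h).1 (Prod.ext_iff.1 h).2 h'
  · intro i
    exact Prod.ext (γ.mem_colGroup.1 hτ i).1 (γ.mem_colGroup.1 hτ i).2

theorem SemistandardFilling.energy_lt_of_apply_ne_zero {γ : MultiPartition k n} {S T : Fin n → α}
    (hS : γ.SemistandardFilling S) (hT : γ.SemistandardFilling T) (hne : S ≠ T)
    (h : γ.youngVector T S ≠ 0) : energy γ.row S < energy γ.row T := by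
  classical
  rw [youngVector_apply] at h
  obtain ⟨π, hπ, h⟩ := Finset.exists_ne_zero_of_sum_ne_zero h
  obtain ⟨τ, hτ, h⟩ := Finset.exists_ne_zero_of_sum_ne_zero h
  have he : T ∘ τ ∘ π = S := by
    by_contra hc
    simp [hc] at h
  have := hT.energy_term_le hπ hτ
  rw [he] at this
  refine lt_of_le_of_ne this.1 fun heq => ?_
  have h1 := this.2 heq
  subst h1
  apply hne
  rw [← he]
  refine WeaklySorted.comp_perm_eq (cls := fun c => (γ.block c, γ.row c)) (pos := γ.col)
    (fun x y h h' => γ.letter_ext (Prod.ext_iff.1 h).1 (Prod.ext_iff.1 h).2 h')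
    (fun x y h h' => hT.row_weak x y (Prod.ext_iff.1 h).1 (Prod.ext_iff.1 h).2 h')
    (fun i => Prod.ext (γ.mem_rowGroup.1 hπ i).1 (γ.mem_rowGroup.1 hπ i).2) (fun x y h h' => ?_)
  have e : T ∘ π = S := he
  rw [e]
  exact hS.row_weak x y (Prod.ext_iff.1 h).1 (Prod.ext_iff.1 h).2 h'

theorem SemistandardFilling.youngVector_apply_self {γ : MultiPartition k n} {T : Fin n → α}
    (hT : γ.SemistandardFilling T) : γ.youngVector T T ≠ 0 := by
  classical
  have h1 : (1 : Equiv.Perm (Fin n)) ∈ γ.colGroup := by simp [mem_colGroup]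
  rw [youngVector_apply, Finset.sum_congr rfl fun π hπ => Finset.sum_eq_single_of_mem 1 h1
    fun τ hτ hτ1 => if_neg fun h => hτ1 ((hT.energy_term_le hπ hτ).2 (by rw [h]))]
  simp only [Equiv.Perm.sign_one, Units.val_one, Int.cast_one, Finset.sum_boole]
  rw [Nat.cast_ne_zero, ← Nat.pos_iff_ne_zero, Finset.card_pos]
  exact ⟨1, by simp [mem_rowGroup]⟩

/-- The vectors of the semistandard fillings are linearly independent: their coefficients are
triangular with respect to the energy along rows. -/
theorem linearIndependent_youngVector :
    LinearIndependent ℂ (fun T : {T : Fin n → α // γ.SemistandardFilling T} =>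
      γ.youngVector T.1) := by
  classical
  rw [linearIndependent_iff]
  intro l hl
  by_contra hne
  obtain ⟨T, hT, hmax⟩ := Finset.exists_max_image l.support (fun T => energy γ.row T.1)
    (Finsupp.support_nonempty_iff.2 hne)
  have h := DFunLike.congr_fun hl T.1
  rw [Finsupp.linearCombination_apply, Finsupp.sum, Finsupp.finsetSum_apply,
    Finset.sum_eq_single_of_mem T hT] at h
  · simp only [Finsupp.smul_apply, smul_eq_mul, Finsupp.coe_zero, Pi.zero_apply, mul_eq_zero] at h
    exact h.elim (Finsupp.mem_support_iff.1 hT) T.2.youngVector_apply_self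
  · intro U hU hUT
    rw [Finsupp.smul_apply, smul_eq_mul]
    refine mul_eq_zero_of_right _ ?_
    by_contra hc
    exact absurd (T.2.energy_lt_of_apply_ne_zero U.2 (fun h => hUT (Subtype.ext h.symm)) hc)
      (not_lt.2 (hmax U hU))

end MultiPartition

/-! ### Multiplicities in left ideals of the group algebra -/

namespace Representation

variable {G V : Type*} [Group G] [AddCommGroup V] [Module ℂ V]

theorem ofModule'_ideal_apply (I : Ideal (MonoidAlgebra ℂ G)) (g : G) (x : I) :
    (ofModule' (k := ℂ) (G := G) I) g x = MonoidAlgebra.single g (1 : ℂ) • x := by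
  rfl

theorem intertwiningMap_smul (ρ : Representation ℂ G V) (I : Ideal (MonoidAlgebra ℂ G))
    (φ : IntertwiningMap (ofModule' (k := ℂ) (G := G) I) ρ) (a : MonoidAlgebra ℂ G) (x : I) :
    φ (a • x) = ρ.asAlgebraHom a (φ x) := by
  induction a using MonoidAlgebra.induction_linear with
  | zero => simp
  | add a b ha hb => rw [add_smul, map_add, ha, hb, map_add, LinearMap.add_apply]
  | single g c =>
    have h : MonoidAlgebra.single g c = c • MonoidAlgebra.single g (1 : ℂ) := by simp
    rw [h, smul_assoc, map_smul, ← ofModule'_ideal_apply, φ.isIntertwining, map_smul,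
      asAlgebraHom_single_one, LinearMap.smul_apply]

/-- Evaluation at `e` of the intertwining maps from the left ideal generated by `e`. -/
def evalGenerator (ρ : Representation ℂ G V) (e : MonoidAlgebra ℂ G) :
    IntertwiningMap (ofModule' (k := ℂ) (G := G) (Ideal.span {e} : Ideal (MonoidAlgebra ℂ G))) ρ
      →ₗ[ℂ] V where
  toFun φ := φ ⟨e, Ideal.mem_span_singleton_self e⟩
  map_add' _ _ := rfl
  map_smul' _ _ := rfl

theorem evalGenerator_injective (ρ : Representation ℂ G V) (e : MonoidAlgebra ℂ G) :
    Function.Injective (evalGenerator ρ e) := by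
  rw [injective_iff_map_eq_zero]
  intro φ hφ
  ext ⟨x, hx⟩
  obtain ⟨a, rfl⟩ := Ideal.mem_span_singleton'.1 hx
  have := intertwiningMap_smul ρ _ φ a ⟨e, Ideal.mem_span_singleton_self e⟩
  change φ _ = 0
  change φ _ = 0 at hφ
  rw [hφ, map_zero] at this
  exact this

/-- By complete reducibility, intertwining maps out of a left ideal are right multiplications by a
vector, so that their values on the generator `e` form the image of `e`. -/
theorem range_evalGenerator [Finite G] (ρ : Representation ℂ G V) (e : MonoidAlgebra ℂ G) :
    LinearMap.range (evalGenerator ρ e) = LinearMap.range (ρ.asAlgebraHom e) := by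
  set I : Ideal (MonoidAlgebra ℂ G) := Ideal.span {e} with hI
  apply le_antisymm
  · rintro _ ⟨φ, rfl⟩
    obtain ⟨J, hJ⟩ := MonoidAlgebra.Submodule.exists_isCompl (k := ℂ) (G := G) I
    let p := I.projectionOnto J hJ
    have he : e • p 1 = ⟨e, Ideal.mem_span_singleton_self e⟩ := by
      rw [← map_smul, smul_eq_mul, mul_one]
      exact Submodule.projectionOnto_apply_left hJ ⟨e, Ideal.mem_span_singleton_self e⟩
    refine ⟨φ (p 1), ?_⟩
    rw [← intertwiningMap_smul, he]
    rfl
  · rintro _ ⟨v, rfl⟩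
    let l : I →ₗ[ℂ] V :=
      { toFun := fun x => ρ.asAlgebraHom x.1 v
        map_add' := fun x y => by simp
        map_smul' := fun c x => by simp }
    refine ⟨LinearMap.intertwiningMap_of_isIntertwiningMap _ _ l fun g x => ?_, rfl⟩
    change ρ.asAlgebraHom (MonoidAlgebra.single g (1 : ℂ) * x.1) v = ρ g (ρ.asAlgebraHom x.1 v)
    rw [map_mul, asAlgebraHom_single_one]
    rfl

/-- The multiplicity of the left ideal generated by `e` in a representation is the rank of `e`. -/
theorem card_inv_mul_sum_char_span_singleton [Fintype G] [FiniteDimensional ℂ V]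
    (ρ : Representation ℂ G V) (e : MonoidAlgebra ℂ G) :
    (Fintype.card G : ℂ)⁻¹ * ∑ g : G, ρ.character g *
      (ofModule' (k := ℂ) (G := G) (Ideal.span {e} : Ideal (MonoidAlgebra ℂ G))).character g⁻¹ =
      Module.finrank ℂ (LinearMap.range (ρ.asAlgebraHom e)) := by
  have : Invertible (Nat.card G : ℂ) := invertibleOfNonzero (by simp)
  have : FiniteDimensional ℂ (MonoidAlgebra ℂ G) := inferInstance
  have : FiniteDimensional ℂ (Ideal.span {e} : Ideal (MonoidAlgebra ℂ G)) :=
    FiniteDimensional.finiteDimensional_submodule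
      ((Ideal.span {e} : Ideal (MonoidAlgebra ℂ G)).restrictScalars ℂ)
  rw [← Nat.card_eq_fintype_card, card_inv_mul_sum_char_mul_char_eq_finrank,
    ← range_evalGenerator, LinearMap.finrank_range_of_inj (evalGenerator_injective ρ e)]

end Representation

section MonomialTrace

/-- The trace of an operator which permutes the vectors of a basis up to scalars. -/
theorem trace_of_monomial {ι V : Type*} [Fintype ι] [DecidableEq ι] [AddCommGroup V] [Module ℂ V]
    (b : Module.Basis ι ℂ V) (f : V →ₗ[ℂ] V) (c : ι → ℂ) (p : ι → ι)
    (h : ∀ i, f (b i) = c i • b (p i)) :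
    LinearMap.trace ℂ V f = ∑ i, if p i = i then c i else 0 := by
  rw [LinearMap.trace_eq_matrix_trace ℂ b, Matrix.trace]
  refine Finset.sum_congr rfl fun i _ => ?_
  rw [Matrix.diag_apply, LinearMap.toMatrix_apply, h, map_smul, b.repr_self, Finsupp.smul_apply,
    Finsupp.single_apply]
  simp

end MonomialTrace

/-! ### Monomial bases of the affine semigroup algebra -/

theorem latticeVec_zero {ι : Type*} : latticeVec (0 : ι → ℤ) = 0 := by
  funext j
  simp [latticeVec]

theorem latticeVec_add {ι : Type*} (v w : ι → ℤ) :
    latticeVec (v + w) = latticeVec v + latticeVec w := by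
  funext j
  simp [latticeVec]

theorem add_mem_dilationPoints {ι : Type*} {Q : Set (ι → ℝ)} (hQ : Convex ℝ Q) {d e : ℕ}
    {v w : ι → ℤ} (hv : v ∈ dilationPoints Q d) (hw : w ∈ dilationPoints Q e) :
    v + w ∈ dilationPoints Q (d + e) := by
  change latticeVec (v + w) ∈ ((d + e : ℕ) : ℝ) • Q
  rw [latticeVec_add, Nat.cast_add, hQ.add_smul (Nat.cast_nonneg d) (Nat.cast_nonneg e)]
  exact Set.add_mem_add hv hw

theorem zero_mem_dilationPoints {ι : Type*} {Q : Set (ι → ℝ)} (hQ : Q.Nonempty) :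
    (0 : ι → ℤ) ∈ dilationPoints Q 0 := by
  change latticeVec (0 : ι → ℤ) ∈ ((0 : ℕ) : ℝ) • Q
  obtain ⟨x, hx⟩ := hQ
  exact ⟨x, hx, by simp [latticeVec_zero]⟩

theorem IsFullLatticePolytope.convex {m : ℕ} {P : Set (Fin m → ℝ)}
    (hP : IsFullLatticePolytope P) : Convex ℝ P := by
  obtain ⟨⟨S, rfl⟩, -⟩ := hP
  exact convex_convexHull ℝ _

theorem IsFullLatticePolytope.nonempty {m : ℕ} {P : Set (Fin m → ℝ)}
    (hP : IsFullLatticePolytope P) : P.Nonempty := by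
  rw [← affineSpan_nonempty ℝ, hP.2]
  exact Set.univ_nonempty

theorem IsFullLatticePolytope.finite_dilationPoints {m : ℕ} {P : Set (Fin m → ℝ)}
    (hP : IsFullLatticePolytope P) (d : ℕ) : (dilationPoints P d).Finite := by
  obtain ⟨⟨S, rfl⟩, -⟩ := hP
  have hb : Bornology.IsBounded ((d : ℝ) • convexHull ℝ (latticeVec '' (S : Set (Fin m → ℤ)))) :=
    ((isBounded_convexHull.2 (S.finite_toSet.image _).isBounded).smul₀ _)
  obtain ⟨C, hC⟩ := hb.exists_norm_le
  refine (Set.finite_Icc (fun _ : Fin m => -⌈C⌉) (fun _ => ⌈C⌉)).subset fun v hv => ?_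
  have h : ∀ j, |(v j : ℝ)| ≤ C := fun j => (norm_le_pi_norm (latticeVec v) j).trans (hC _ hv)
  refine ⟨fun j => ?_, fun j => ?_⟩
  · have h1 := (abs_le.1 (h j)).1
    have h2 := Int.le_ceil C
    have : ((-⌈C⌉ : ℤ) : ℝ) ≤ (v j : ℝ) := by push_cast; linarith
    exact_mod_cast this
  · have h1 := (abs_le.1 (h j)).2
    have h2 := Int.le_ceil C
    have : (v j : ℝ) ≤ ((⌈C⌉ : ℤ) : ℝ) := by linarith
    exact_mod_cast this

theorem convex_cartesianPower (n : ℕ) {m : ℕ} {P : Set (Fin m → ℝ)} (hP : Convex ℝ P) :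
    Convex ℝ (cartesianPower n P) :=
  fun _ hx _ hy _ _ ha hb hab i => hP (hx i) (hy i) ha hb hab

theorem nonempty_cartesianPower (n : ℕ) {m : ℕ} {P : Set (Fin m → ℝ)} (hP : P.Nonempty) :
    (cartesianPower n P).Nonempty :=
  ⟨fun ij => hP.some ij.2, fun _ => hP.some_mem⟩

theorem uncurry_mem_dilationPoints {n m : ℕ} {P : Set (Fin m → ℝ)} {d : ℕ}
    {f : Fin n → Fin m → ℤ} :
    Function.uncurry f ∈ dilationPoints (cartesianPower n P) d ↔
      ∀ i, f i ∈ dilationPoints P d := by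
  constructor
  · rintro ⟨x, hx, hxf⟩ i
    exact ⟨fun j => x (i, j), hx i, funext fun j => congrFun hxf (i, j)⟩
  · intro h
    choose x hx hxf using h
    exact ⟨Function.uncurry x, hx, funext fun ij => congrFun (hxf ij.1) ij.2⟩

/-- The affine semigroup algebra of a nonempty convex set consists of the combinations of its
monomials: sums of lattice points of `dQ` and `eQ` are lattice points of `(d + e)Q`. -/
theorem mem_semigroupAlgebra {ι : Type*} {Q : Set (ι → ℝ)} (hc : Convex ℝ Q) (hn : Q.Nonempty)
    {x : MonomialRing ι} :
    x ∈ semigroupAlgebra Q ↔ ∀ e ∈ x.coeff.support, e.2 ∈ dilationPoints Q e.1 := by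
  classical
  constructor
  · intro hx
    induction hx using Algebra.adjoin_induction with
    | mem x hx =>
      obtain ⟨d, v, hv, rfl⟩ := hx
      intro e he
      rw [Finset.mem_singleton.1 (Finsupp.support_single_subset he)]
      exact hv
    | algebraMap r =>
      intro e he
      rw [Finset.mem_singleton.1 (Finsupp.support_single_subset he)]
      exact zero_mem_dilationPoints hn
    | add x y _ _ hx hy =>
      intro e he
      rcases Finset.mem_union.1 (Finsupp.support_add he) with h | h
      · exact hx e h
      · exact hy e h
    | mul x y _ _ hx hy =>
      intro e he
      obtain ⟨a, ha, b, hb, rfl⟩ :=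
        Finset.mem_add.1 (AddMonoidAlgebra.support_coeff_mul_subset x y he)
      exact add_mem_dilationPoints hc (hx a ha) (hy b hb)
  · intro h
    rw [← x.sum_coeff_single]
    refine Subalgebra.sum_mem _ fun e he => ?_
    have : AddMonoidAlgebra.single e (x.coeff e) =
        x.coeff e • AddMonoidAlgebra.single (e.1, e.2) (1 : ℂ) := by simp
    rw [this]
    refine Subalgebra.smul_mem _ (Algebra.subset_adjoin ?_) _
    exact ⟨e.1, e.2, h e he, rfl⟩

section Monomials

variable {k n m : ℕ}

/-- The monomial `t^d ∏_{i,j} x_{i,j}^{(f_i)_j}`. -/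
def fillingMonomial (d : ℕ) (f : Fin n → Fin m → ℤ) : MonomialRing (Fin n × Fin m) :=
  AddMonoidAlgebra.single (d, Function.uncurry f) 1

/-- The combinatorial degree `∑_i a'·f_i`. -/
def fillingDegree (a' : Fin m → ℤ) (f : Fin n → Fin m → ℤ) : ℤ := ∑ i, a' ⬝ᵥ f i

theorem weightVector_dot_uncurry (a' : Fin m → ℤ) (f : Fin n → Fin m → ℤ) :
    weightVector n a' ⬝ᵥ Function.uncurry f = fillingDegree a' f := by
  simp only [dotProduct, weightVector, fillingDegree, Fintype.sum_prod_type]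
  rfl

theorem fillingDegree_comp (a' : Fin m → ℤ) (f : Fin n → Fin m → ℤ) (π : Equiv.Perm (Fin n)) :
    fillingDegree a' (f ∘ π) = fillingDegree a' f :=
  Equiv.sum_comp π fun i => a' ⬝ᵥ f i

theorem linearIndependent_fillingMonomial (d : ℕ) :
    LinearIndependent ℂ (fillingMonomial d : (Fin n → Fin m → ℤ) → _) := by
  have h : Function.Injective fun f : Fin n → Fin m → ℤ => (d, Function.uncurry f) := by
    intro f g hfg
    funext i j
    exact congrFun (Prod.ext_iff.1 hfg).2 (i, j)
  exact ((AddMonoidAlgebra.basis (ℕ × (Fin n × Fin m → ℤ)) ℂ).linearIndependent).comp _ h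

/-- The tuples of lattice points that index the monomial basis of `K[P^{×n}]_{d,j}`. -/
def pieceFillings (n : ℕ) {m : ℕ} (P : Set (Fin m → ℝ)) (a' : Fin m → ℤ) (d : ℕ) (j : ℤ) :
    Set (Fin n → Fin m → ℤ) :=
  {f | (∀ i, f i ∈ dilationPoints P d) ∧ fillingDegree a' f = j}

theorem bigradedPiece_eq_span {P : Set (Fin m → ℝ)} (hP : IsFullLatticePolytope P)
    (a' : Fin m → ℤ) (d : ℕ) (j : ℤ) :
    Submodule.span ℂ (Set.range fun f : pieceFillings n P a' d j => fillingMonomial d f.1) =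
      bigradedPiece n P a' d j := by
  have hmem := fun x => mem_semigroupAlgebra (x := x) (convex_cartesianPower n hP.convex)
    (nonempty_cartesianPower n hP.nonempty)
  apply le_antisymm
  · rw [Submodule.span_le]
    rintro _ ⟨⟨f, hf, hfj⟩, rfl⟩
    refine ⟨(hmem _).2 fun e he => ?_, fun e he => ?_⟩ <;>
      rw [Finset.mem_singleton.1 (Finsupp.support_single_subset he)]
    · exact uncurry_mem_dilationPoints.2 hf
    · exact Prod.ext rfl ((weightVector_dot_uncurry a' f).trans hfj)
  · rintro x ⟨hx1, hx2⟩
    rw [← x.sum_coeff_single]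
    refine Submodule.sum_mem _ fun e he => ?_
    have h1 := (hmem x).1 hx1 e he
    have h2 := hx2 e he
    obtain ⟨d', v⟩ := e
    simp only [Prod.mk.injEq] at h1 h2
    obtain ⟨rfl, h2⟩ := h2
    have : AddMonoidAlgebra.single (d', v) (x.coeff (d', v)) =
        x.coeff (d', v) • fillingMonomial d' (Function.curry v) := by
      simp [fillingMonomial, Function.uncurry_curry]
    rw [this]
    refine Submodule.smul_mem _ _ (Submodule.subset_span ⟨⟨Function.curry v, ?_, ?_⟩, rfl⟩)
    · rw [← uncurry_mem_dilationPoints, Function.uncurry_curry]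
      exact h1
    · rw [← weightVector_dot_uncurry, Function.uncurry_curry]
      exact h2

/-- The monomial basis of `K[P^{×n}]_{d,j}`. -/
def pieceBasis {P : Set (Fin m → ℝ)} (hP : IsFullLatticePolytope P)
    (a' : Fin m → ℤ) (d : ℕ) (j : ℤ) :
    Module.Basis (pieceFillings n P a' d j) ℂ (bigradedPiece n P a' d j) :=
  (Module.Basis.span ((linearIndependent_fillingMonomial (n := n) (m := m) d).comp _
    Subtype.val_injective)).map (LinearEquiv.ofEq _ _ (bigradedPiece_eq_span hP a' d j))

theorem coe_pieceBasis {P : Set (Fin m → ℝ)} (hP : IsFullLatticePolytope P)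
    (a' : Fin m → ℤ) (d : ℕ) (j : ℤ) (f : pieceFillings n P a' d j) :
    (pieceBasis hP a' d j f : MonomialRing (Fin n × Fin m)) = fillingMonomial d f.1 := by
  rw [pieceBasis, Module.Basis.map_apply, LinearEquiv.coe_ofEq_apply, Module.Basis.span_apply]
  rfl

theorem wreathAct_fillingMonomial (σ : WreathProduct k n) (d : ℕ) (f : Fin n → Fin m → ℤ) :
    wreathAct σ (fillingMonomial d f) =
      (actScalar σ (Function.uncurry f) : ℂ) • fillingMonomial d (f ∘ ⇑σ.right⁻¹) := by
  rw [fillingMonomial, wreathAct_single, fillingMonomial, AddMonoidAlgebra.smul_single, one_mul,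
    smul_eq_mul, mul_one]
  rfl

theorem finite_latticeFillings {P : Set (Fin m → ℝ)} (hP : IsFullLatticePolytope P)
    (n d : ℕ) : {f : Fin n → Fin m → ℤ | ∀ i, f i ∈ dilationPoints P d}.Finite :=
  Set.Finite.pi' fun _ => hP.finite_dilationPoints d

theorem finite_pieceFillings {P : Set (Fin m → ℝ)} (hP : IsFullLatticePolytope P)
    (a' : Fin m → ℤ) (d : ℕ) (j : ℤ) : (pieceFillings n P a' d j).Finite :=
  (finite_latticeFillings hP n d).subset fun _ hf => hf.1

theorem comp_mem_pieceFillings {P : Set (Fin m → ℝ)} {a' : Fin m → ℤ} {d : ℕ} {j : ℤ}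
    {f : Fin n → Fin m → ℤ} (hf : f ∈ pieceFillings n P a' d j) (π : Equiv.Perm (Fin n)) :
    f ∘ π ∈ pieceFillings n P a' d j :=
  ⟨fun i => hf.1 (π i), (fillingDegree_comp a' f π).trans hf.2⟩

/-- The tuples of lattice points of `dP`. -/
def latticeFillings {P : Set (Fin m → ℝ)} (hP : IsFullLatticePolytope P) (n d : ℕ) :
    Finset (Fin n → Fin m → ℤ) :=
  (finite_latticeFillings hP n d).toFinset

theorem mem_latticeFillings {P : Set (Fin m → ℝ)} (hP : IsFullLatticePolytope P) {d : ℕ}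
    {f : Fin n → Fin m → ℤ} :
    f ∈ latticeFillings hP n d ↔ ∀ i, f i ∈ dilationPoints P d := by
  simp [latticeFillings]

open Classical in
/-- The trace of `σ` on a bigraded component is the sum of the scalars of the fixed monomials. -/
theorem character_bigradedPieceRep {P : Set (Fin m → ℝ)} (hP : IsFullLatticePolytope P)
    (a' : Fin m → ℤ) (d : ℕ) (j : ℤ) (σ : WreathProduct k n) :
    (bigradedPieceRep k n P a' d j).character σ =
      ∑ f ∈ (latticeFillings hP n d).filter (fun f => fillingDegree a' f = j),
        if f ∘ ⇑σ.right⁻¹ = f then (actScalar σ (Function.uncurry f) : ℂ) else 0 := by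
  have : Fintype (pieceFillings n P a' d j) := (finite_pieceFillings hP a' d j).fintype
  rw [Representation.character, trace_of_monomial (pieceBasis hP a' d j) _
    (fun f => (actScalar σ (Function.uncurry f.1) : ℂ))
    (fun f => ⟨f.1 ∘ ⇑σ.right⁻¹, comp_mem_pieceFillings f.2 _⟩)]
  · simp only [Subtype.ext_iff]
    refine Finset.sum_bij (fun f _ => f.1) ?_ (fun f _ g _ h => Subtype.ext h) ?_ fun f _ => rfl
    · intro f _
      rw [Finset.mem_filter, mem_latticeFillings]
      exact f.2
    · intro f hf
      rw [Finset.mem_filter, mem_latticeFillings] at hf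
      exact ⟨⟨f, hf⟩, Finset.mem_univ _, rfl⟩
  · intro f
    apply Subtype.ext
    rw [Submodule.coe_smul, coe_pieceBasis]
    change wreathAct σ (pieceBasis hP a' d j f : MonomialRing (Fin n × Fin m)) = _
    rw [coe_pieceBasis, wreathAct_fillingMonomial]

theorem pieceCharacter_eq_sum_components {P : Set (Fin m → ℝ)} (hP : IsFullLatticePolytope P)
    (a' : Fin m → ℤ) (d : ℕ) (σ : WreathProduct k n) :
    pieceCharacter P a' d σ =
      ∑ j ∈ (latticeFillings hP n d).image (fillingDegree a'),
        (bigradedPieceRep k n P a' d j).character σ • LaurentPolynomial.T j := by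
  classical
  refine finsum_eq_sum_of_support_subset _ fun j hj => ?_
  by_contra hc
  refine hj ?_
  change (bigradedPieceRep k n P a' d j).character σ • LaurentPolynomial.T j = 0
  rw [character_bigradedPieceRep hP, Finset.sum_eq_zero, zero_smul]
  intro f hf
  rw [Finset.mem_filter] at hf
  exact absurd (Finset.mem_coe.2 (Finset.mem_image.2 ⟨f, hf⟩)) hc

open Classical in
theorem pieceCharacter_eq_sum {P : Set (Fin m → ℝ)} (hP : IsFullLatticePolytope P)
    (a' : Fin m → ℤ) (d : ℕ) (σ : WreathProduct k n) :
    pieceCharacter P a' d σ =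
      ∑ f ∈ (latticeFillings hP n d).filter (fun f => f ∘ ⇑σ.right⁻¹ = f),
        (actScalar σ (Function.uncurry f) : ℂ) • LaurentPolynomial.T (fillingDegree a' f) := by
  rw [pieceCharacter_eq_sum_components hP, Finset.sum_filter, ← Finset.sum_fiberwise_of_maps_to
    (fun f hf => Finset.mem_image_of_mem (fillingDegree a') hf)]
  refine Finset.sum_congr rfl fun j _ => ?_
  rw [character_bigradedPieceRep hP, Finset.sum_smul]
  refine Finset.sum_congr rfl fun f hf => ?_
  rw [(Finset.mem_filter.1 hf).2, ite_smul, zero_smul]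

/-! ### Colorings and fixed monomials -/

/-- The colorings of `σ` are the fixed points of its underlying permutation. -/
theorem constant_on_cycles_iff {α : Type*} (σ : Equiv.Perm (Fin n)) (f : Fin n → α) :
    (∀ i j, Equiv.Perm.SameCycle σ i j → f i = f j) ↔ f ∘ ⇑σ⁻¹ = f := by
  constructor
  · intro h
    funext i
    exact h _ _ ⟨1, by simp⟩
  · intro h
    have h1 : ∀ i, f (σ i) = f i := fun i => by
      have := congrFun h (σ i)
      simpa using this.symm
    rintro i j ⟨z, rfl⟩
    induction z with
    | zero => rfl
    | succ z ih =>
      rw [add_comm, zpow_add, zpow_one, Equiv.Perm.mul_apply, h1]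
      exact ih
    | pred z ih =>
      rw [ih, sub_eq_add_neg, add_comm, zpow_add, Equiv.Perm.mul_apply, zpow_neg_one]
      exact (congrFun h _).symm

theorem actScalar_of_fixed (σ : WreathProduct k n) {f : Fin n → Fin m → ℤ}
    (hf : f ∘ ⇑σ.right⁻¹ = f) :
    actScalar σ (Function.uncurry f) = ∏ i, σ.root i ^ (∑ j, f i j) := by
  rw [actScalar, ← Equiv.prod_comp σ.right fun i => σ.root i ^ (∑ j, f i j)]
  refine Finset.prod_congr rfl fun i _ => ?_
  have := congrFun hf (σ.right i)
  simp only [Function.comp_apply] at this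
  rw [← this]
  simp [Function.uncurry]

theorem prod_T {ι : Type*} (s : Finset ι) (w : ι → ℤ) :
    ∏ i ∈ s, (LaurentPolynomial.T (w i) : LaurentPolynomial ℂ) =
      LaurentPolynomial.T (∑ i ∈ s, w i) := by
  classical
  induction s using Finset.induction_on with
  | empty => simp
  | insert a s ha ih => rw [Finset.prod_insert ha, Finset.sum_insert ha, ih, LaurentPolynomial.T_add]

/-- Multiplicities that are either zero or at least the number of places only restrict the colors
that may be used. -/
theorem forall_card_le_iff {ι α : Type*} [Finite ι] {N : ℕ} (hN : Nat.card ι ≤ N) (f : ι → α)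
    (p : α → Prop) [DecidablePred p] :
    (∀ c, Nat.card {i // f i = c} ≤ if p c then N else 0) ↔ ∀ i, p (f i) := by
  constructor
  · intro h i
    by_contra hi
    have := h (f i)
    rw [if_neg hi, Nat.le_zero, Nat.card_eq_zero] at this
    rcases this with h1 | h1
    · exact h1.false ⟨i, rfl⟩
    · exact h1.not_finite inferInstance
  · intro h c
    split_ifs with hc
    · exact (Nat.card_le_card_of_injective _ Subtype.val_injective).trans hN
    · rw [Nat.le_zero, Nat.card_eq_zero]
      exact Or.inl ⟨fun i => hc (i.2 ▸ h i.1)⟩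

theorem character_polytopeColorRule {P : Set (Fin m → ℝ)} (hP : IsFullLatticePolytope P)
    (a' : Fin m → ℤ) (d : ℕ) (σ : WreathProduct k n) :
    (polytopeColorRule n P a' d).character σ = pieceCharacter P a' d σ := by
  classical
  have hset : {f : Fin n → Fin m → ℤ | (polytopeColorRule n P a' d).IsColoring σ f} =
      ↑((latticeFillings hP n d).filter (fun f => f ∘ ⇑σ.right⁻¹ = f)) := by
    ext f
    rw [Set.mem_ofPred_eq, Finset.mem_coe, Finset.mem_filter, mem_latticeFillings,
      ← constant_on_cycles_iff]
    refine and_congr_left' ?_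
    have := forall_card_le_iff (N := n) (by simp) f (· ∈ dilationPoints P d)
    rw [← this]
    unfold polytopeColorRule
    refine forall_congr' fun c => ?_
    simp only
  rw [ColorRule.character, hset, finsum_mem_coe_finset, pieceCharacter_eq_sum hP]
  refine Finset.sum_congr rfl fun f hf => ?_
  rw [actScalar_of_fixed σ (Finset.mem_filter.1 hf).2, Finset.prod_smul, fillingDegree]
  congr 1
  · rw [Units.coe_prod]
    rfl
  · exact prod_T _ _

end Monomials

/-! ### The image of the Young symmetrizer on a bigraded component -/

section YoungImage

variable {k n m : ℕ}

theorem wreathRep_inr_fillingMonomial (π : Equiv.Perm (Fin n)) (d : ℕ) (f : Fin n → Fin m → ℤ) :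
    wreathRep k n m (SemidirectProduct.inr π) (fillingMonomial d f) =
      fillingMonomial d (f ∘ ⇑π⁻¹) := by
  change wreathAct _ _ = _
  rw [wreathAct_fillingMonomial]
  simp [actScalar, WreathProduct.root]

theorem wreathRep_inl_fillingMonomial (z : Fin n → rootsOfUnity k ℂ) (d : ℕ)
    (f : Fin n → Fin m → ℤ) :
    wreathRep k n m (SemidirectProduct.inl z) (fillingMonomial d f) =
      ((∏ i, (z i : ℂˣ) ^ (∑ j, f i j) : ℂˣ) : ℂ) • fillingMonomial d f := by
  change wreathAct _ _ = _
  rw [wreathAct_fillingMonomial]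
  rfl

theorem sum_rootsOfUnity_zpow [NeZero k] (a : ℤ) :
    ∑ u : rootsOfUnity k ℂ, (((u : ℂˣ) ^ a : ℂˣ) : ℂ) = if a ≡ 0 [ZMOD k] then (k : ℂ) else 0 := by
  classical
  let φ : rootsOfUnity k ℂ →* ℂ :=
    (Units.coeHom ℂ).comp ((zpowGroupHom a).comp (rootsOfUnity k ℂ).subtype)
  have h := sum_hom_units φ
  have hφ : φ = 1 ↔ a ≡ 0 [ZMOD k] := by
    rw [Int.modEq_zero_iff_dvd]
    constructor
    · intro h1
      have hζ := (Complex.isPrimitiveRoot_exp k (NeZero.ne k)).isUnit_unit (NeZero.ne k)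
      rw [← hζ.zpow_eq_one_iff_dvd]
      have := DFunLike.congr_fun h1 (⟨_, (mem_rootsOfUnity k _).2 hζ.pow_eq_one⟩)
      exact Units.ext this
    · rintro ⟨b, rfl⟩
      ext u
      have hu := (mem_rootsOfUnity k _).1 u.2
      change (((u : ℂˣ) ^ ((k : ℤ) * b) : ℂˣ) : ℂ) = 1
      rw [zpow_mul, zpow_natCast, hu, one_zpow, Units.val_one]
  have hcard : Fintype.card (rootsOfUnity k ℂ) = k := by
    rw [← Nat.card_eq_fintype_card]
    exact Complex.card_rootsOfUnity k
  simp only [hφ, hcard] at h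
  exact_mod_cast h

namespace MultiPartition

variable (γ : MultiPartition k n)

/-- The values of the entries of the filling `f` are congruent to the index of their block. -/
def ResidueFilling (f : Fin n → Fin m → ℤ) : Prop :=
  ∀ i, (∑ j, f i j) ≡ (γ.block i : ℕ) [ZMOD k]

theorem residueFilling_comp_iff (f : Fin n → Fin m → ℤ) {π : Equiv.Perm (Fin n)}
    (hπ : ∀ i, γ.block (π i) = γ.block i) :
    γ.ResidueFilling (f ∘ π) ↔ γ.ResidueFilling f := by
  constructor
  · intro h i
    have h1 := h (π.symm i)
    have h2 := hπ (π.symm i)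
    rw [Equiv.apply_symm_apply] at h2
    rw [← h2, Function.comp_apply, Equiv.apply_symm_apply] at h1
    exact h1
  · intro h i
    rw [← hπ i]
    exact h (π i)

/-- The linear map which replaces fillings by the corresponding monomials. -/
def fillingMap (n m d : ℕ) : ((Fin n → Fin m → ℤ) →₀ ℂ) →ₗ[ℂ] MonomialRing (Fin n × Fin m) :=
  Finsupp.linearCombination ℂ (fillingMonomial d)

theorem fillingMap_single (d : ℕ) (f : Fin n → Fin m → ℤ) :
    fillingMap n m d (Finsupp.single f 1) = fillingMonomial d f := by
  simp [fillingMap]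

open Classical in
theorem asAlgebraHom_blockSymmetrizer [NeZero k] (d : ℕ) (f : Fin n → Fin m → ℤ) :
    (wreathRep k n m).asAlgebraHom γ.blockSymmetrizer (fillingMonomial d f) =
      (if γ.ResidueFilling f then (k : ℂ) ^ n else 0) • fillingMonomial d f := by
  -- Each factor is a character sum of a copy of `Z_k`.
  have h : ∏ i, ∑ u : rootsOfUnity k ℂ, (((u : ℂˣ) ^ ((∑ j, f i j) - (γ.block i : ℕ)) : ℂˣ) : ℂ) =
      if γ.ResidueFilling f then (k : ℂ) ^ n else 0 := by
    simp only [sum_rootsOfUnity_zpow]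
    have hiff : ∀ i, ((∑ j, f i j) - (γ.block i : ℕ) ≡ 0 [ZMOD k]) ↔
        (∑ j, f i j) ≡ (γ.block i : ℕ) [ZMOD k] := fun i => by
      rw [Int.modEq_zero_iff_dvd, Int.modEq_comm, Int.modEq_iff_dvd]
    simp only [hiff]
    split_ifs with hf
    · rw [Finset.prod_congr rfl fun i _ => if_pos (hf i)]
      simp
    · unfold ResidueFilling at hf
      push Not at hf
      obtain ⟨i, hi⟩ := hf
      exact Finset.prod_eq_zero (Finset.mem_univ i) (if_neg hi)
  rw [← h, Finset.prod_univ_sum, Fintype.piFinset_univ, blockSymmetrizer, map_sum,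
    LinearMap.sum_apply, Finset.sum_smul]
  refine Finset.sum_congr rfl fun z _ => ?_
  rw [Representation.asAlgebraHom_single, LinearMap.smul_apply, wreathRep_inl_fillingMonomial,
    smul_smul, ← Units.val_mul, ← Units.coe_prod, ← Finset.prod_mul_distrib]
  congr 2
  refine Finset.prod_congr rfl fun i _ => ?_
  rw [zpow_sub, zpow_natCast, mul_comm]

theorem asAlgebraHom_row_mul_col (d : ℕ) (f : Fin n → Fin m → ℤ) :
    (wreathRep k n m).asAlgebraHom (γ.rowSymmetrizer * γ.colSymmetrizer) (fillingMonomial d f) =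
      fillingMap n m d (γ.youngVector f) := by
  simp only [map_mul, Module.End.mul_apply, rowSymmetrizer, colSymmetrizer, map_sum,
    LinearMap.sum_apply, Representation.asAlgebraHom_single, one_smul, LinearMap.smul_apply,
    wreathRep_inr_fillingMonomial, map_smul, youngVector, fillingMap_single]
  rw [Finset.sum_comm]
  refine Finset.sum_equiv (Equiv.inv _) (fun τ => ⟨γ.inv_mem_colGroup, fun h => by
    simpa using γ.inv_mem_colGroup h⟩) fun τ _ => ?_
  rw [Finset.smul_sum]
  refine Finset.sum_equiv (Equiv.inv _) (fun π => ⟨γ.inv_mem_rowGroup, fun h => by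
    simpa using γ.inv_mem_rowGroup h⟩) fun π _ => ?_
  rw [Equiv.inv_apply, Equiv.Perm.sign_inv]
  rfl

open Classical in
/-- The Young symmetrizer sends a monomial to a multiple of the vector of its filling, which
vanishes unless all entries have the residues prescribed by their blocks. -/
theorem asAlgebraHom_youngSymmetrizer [NeZero k] (d : ℕ) (f : Fin n → Fin m → ℤ) :
    (wreathRep k n m).asAlgebraHom γ.youngSymmetrizer (fillingMonomial d f) =
      (if γ.ResidueFilling f then (k : ℂ) ^ n else 0) • fillingMap n m d (γ.youngVector f) := by
  rw [youngSymmetrizer, map_mul, Module.End.mul_apply, asAlgebraHom_row_mul_col]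
  simp only [youngVector, map_sum, map_smul, fillingMap_single, Finset.smul_sum]
  refine Finset.sum_congr rfl fun π hπ => Finset.sum_congr rfl fun τ hτ => ?_
  rw [asAlgebraHom_blockSymmetrizer, smul_comm, ← Function.comp_assoc]
  congr 2
  rw [γ.residueFilling_comp_iff _ fun i => (γ.mem_rowGroup.1 hπ i).1,
    γ.residueFilling_comp_iff _ fun i => (γ.mem_colGroup.1 hτ i).1]

/-- The fillings by lattice points of `dP` that index a basis of the image of the Young symmetrizer
of `γ` on `K[P^{×n}]_{d,j}`. -/
def tableauFillings (ord : LinearOrder (Fin m → ℤ)) (P : Set (Fin m → ℝ)) (a' : Fin m → ℤ) (d : ℕ)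
    (j : ℤ) : Set (Fin n → Fin m → ℤ) :=
  {T | @SemistandardFilling k n γ _ ord T ∧ γ.ResidueFilling T ∧ T ∈ pieceFillings n P a' d j}

theorem asAlgebraHom_bigradedPieceRep (P : Set (Fin m → ℝ)) (a' : Fin m → ℤ) (d : ℕ) (j : ℤ)
    (e : MonoidAlgebra ℂ (WreathProduct k n)) (x : bigradedPiece n P a' d j) :
    (((bigradedPieceRep k n P a' d j).asAlgebraHom e x : bigradedPiece n P a' d j) :
      MonomialRing (Fin n × Fin m)) = (wreathRep k n m).asAlgebraHom e x := by
  induction e using MonoidAlgebra.induction_linear with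
  | zero => simp
  | add a b ha hb =>
    rw [map_add, map_add, LinearMap.add_apply, LinearMap.add_apply, Submodule.coe_add, ha, hb]
  | single g c =>
    rw [Representation.asAlgebraHom_single, Representation.asAlgebraHom_single]
    rfl

theorem map_range_youngSymmetrizer [NeZero k] {P : Set (Fin m → ℝ)}
    (hP : IsFullLatticePolytope P) (ord : LinearOrder (Fin m → ℤ)) (a' : Fin m → ℤ) (d : ℕ)
    (j : ℤ) :
    (LinearMap.range ((bigradedPieceRep k n P a' d j).asAlgebraHom γ.youngSymmetrizer)).map
      (bigradedPiece n P a' d j).subtype =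
    Submodule.span ℂ (Set.range fun T : γ.tableauFillings ord P a' d j =>
      fillingMap n m d (γ.youngVector T.1)) := by
  classical
  have hk : (k : ℂ) ^ n ≠ 0 := pow_ne_zero _ (Nat.cast_ne_zero.2 (NeZero.ne k))
  have himage : ∀ f : pieceFillings n P a' d j,
      (((bigradedPieceRep k n P a' d j).asAlgebraHom γ.youngSymmetrizer (pieceBasis hP a' d j f) :
        bigradedPiece n P a' d j) : MonomialRing (Fin n × Fin m)) =
      (if γ.ResidueFilling f.1 then (k : ℂ) ^ n else 0) •
        fillingMap n m d (γ.youngVector f.1) := fun f => by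
    rw [asAlgebraHom_bigradedPieceRep, coe_pieceBasis, asAlgebraHom_youngSymmetrizer]
  rw [LinearMap.range_eq_map, ← (pieceBasis hP a' d j).span_eq, Submodule.map_span,
    Submodule.map_span]
  apply le_antisymm
  · rw [Submodule.span_le]
    rintro _ ⟨_, ⟨_, ⟨f, rfl⟩, rfl⟩, rfl⟩
    rw [Submodule.coe_subtype, himage, SetLike.mem_coe]
    split_ifs with hf
    · refine Submodule.smul_mem _ _ ?_
      have h := Submodule.mem_map_of_mem (f := fillingMap n m d)
        (@youngVector_mem_span k n γ _ ord f.1)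
      rw [Submodule.map_span] at h
      refine Submodule.span_mono ?_ h
      rintro _ ⟨_, ⟨_, ⟨hT, π, hπ, rfl⟩, rfl⟩, rfl⟩
      exact ⟨⟨f.1 ∘ π, hT, (γ.residueFilling_comp_iff _ hπ).2 hf, comp_mem_pieceFillings f.2 π⟩,
        rfl⟩
    · rw [zero_smul]
      exact Submodule.zero_mem _
  · rw [Submodule.span_le]
    rintro _ ⟨⟨T, hT⟩, rfl⟩
    rw [SetLike.mem_coe, ← Submodule.smul_mem_iff _ hk]
    refine Submodule.subset_span ⟨_, ⟨_, ⟨⟨T, hT.2.2⟩, rfl⟩, rfl⟩, ?_⟩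
    rw [Submodule.coe_subtype, himage, if_pos hT.2.1]

/-- The rank of the Young symmetrizer on a bigraded component counts semistandard fillings. -/
theorem finrank_range_youngSymmetrizer [NeZero k] {P : Set (Fin m → ℝ)}
    (hP : IsFullLatticePolytope P) (ord : LinearOrder (Fin m → ℤ)) (a' : Fin m → ℤ) (d : ℕ)
    (j : ℤ) :
    Module.finrank ℂ
      (LinearMap.range ((bigradedPieceRep k n P a' d j).asAlgebraHom γ.youngSymmetrizer)) =
      Nat.card (γ.tableauFillings ord P a' d j) := by
  have : Fintype (γ.tableauFillings ord P a' d j) :=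
    ((finite_pieceFillings hP a' d j).subset fun _ hT => hT.2.2).fintype
  rw [← Submodule.finrank_map_subtype_eq, γ.map_range_youngSymmetrizer hP ord,
    finrank_span_eq_card, Nat.card_eq_fintype_card]
  have h1 := (@linearIndependent_youngVector k n γ _ ord).comp
    (fun T : γ.tableauFillings ord P a' d j => ⟨T.1, T.2.1⟩)
    (fun S T h => Subtype.ext (by simpa using h))
  refine h1.map' (fillingMap n m d) ?_
  exact LinearMap.ker_eq_bot.2 (linearIndependent_fillingMonomial d)

end MultiPartition

end YoungImage

/-! ### Multiplicities of the irreducible characters -/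

section Multiplicity

variable {k n m : ℕ}

theorem conj_rootsOfUnity [NeZero k] (u : rootsOfUnity k ℂ) :
    starRingEnd ℂ ((u : ℂˣ) : ℂ) = (((u : ℂˣ)⁻¹ : ℂˣ) : ℂ) := by
  have h : ((u : ℂˣ) : ℂ) ^ k = 1 := (mem_rootsOfUnity' k _).1 u.2
  rw [Units.val_inv_eq_inv_val, ← Complex.inv_eq_conj (Complex.norm_eq_one_of_pow_eq_one h
    (NeZero.ne k))]

theorem conj_actScalar_of_fixed [NeZero k] (σ : WreathProduct k n) {f : Fin n → Fin m → ℤ}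
    (hf : f ∘ ⇑σ.right⁻¹ = f) :
    starRingEnd ℂ (actScalar σ (Function.uncurry f) : ℂ) =
      (actScalar σ⁻¹ (Function.uncurry f) : ℂ) := by
  have h1 : starRingEnd ℂ (actScalar σ (Function.uncurry f) : ℂ) =
      (((actScalar σ (Function.uncurry f))⁻¹ : ℂˣ) : ℂ) := by
    rw [actScalar, Units.coe_prod, map_prod, ← Finset.prod_inv_distrib, Units.coe_prod]
    refine Finset.prod_congr rfl fun i _ => ?_
    rw [Units.val_zpow_eq_zpow_val, map_zpow₀, WreathProduct.root, conj_rootsOfUnity,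
      ← Units.val_zpow_eq_zpow_val, inv_zpow]
  -- Compare the coefficients of the fixed monomial in `σ⁻¹ (σ x) = x`.
  have h2 : actScalar σ⁻¹ (Function.uncurry f) * actScalar σ (Function.uncurry f) = 1 := by
    have h := wreathAct_mul σ⁻¹ σ (fillingMonomial 0 f)
    rw [inv_mul_cancel, wreathAct_one, wreathAct_fillingMonomial, map_smul, hf,
      wreathAct_fillingMonomial] at h
    have h3 := congrArg (fun x : MonomialRing (Fin n × Fin m) =>
      x.coeff (0, Function.uncurry f)) h
    have hf' : f ∘ ⇑(σ⁻¹).right⁻¹ = f := by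
      rw [SemidirectProduct.inv_right, inv_inv]
      funext i
      have := congrFun hf (σ.right i)
      simpa using this.symm
    simp only [hf', fillingMonomial, AddMonoidAlgebra.coeff_smul, AddMonoidAlgebra.coeff_single,
      Finsupp.smul_apply, Finsupp.single_eq_same, smul_eq_mul, mul_one] at h3
    apply Units.ext
    rw [mul_comm, Units.val_mul, ← h3, Units.val_one]
  rw [h1, inv_eq_of_mul_eq_one_left h2]

/-- The characters of the bigraded components are complex conjugated by inversion. -/
theorem conj_character_bigradedPieceRep [NeZero k] {P : Set (Fin m → ℝ)}
    (hP : IsFullLatticePolytope P) (a' : Fin m → ℤ) (d : ℕ) (j : ℤ) (σ : WreathProduct k n) :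
    starRingEnd ℂ ((bigradedPieceRep k n P a' d j).character σ) =
      (bigradedPieceRep k n P a' d j).character σ⁻¹ := by
  classical
  rw [character_bigradedPieceRep hP, character_bigradedPieceRep hP, map_sum]
  refine Finset.sum_congr rfl fun f _ => ?_
  have hiff : f ∘ ⇑σ.right⁻¹ = f ↔ f ∘ ⇑(σ⁻¹).right⁻¹ = f := by
    rw [← constant_on_cycles_iff, ← constant_on_cycles_iff, SemidirectProduct.inv_right]
    simp only [Equiv.Perm.sameCycle_inv]
  by_cases hf : f ∘ ⇑σ.right⁻¹ = f
  · rw [if_pos hf, if_pos (hiff.1 hf), conj_actScalar_of_fixed σ hf]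
  · rw [if_neg hf, if_neg fun h => hf (hiff.2 h), map_zero]

/-- The multiplicity of `χ^γ` in a bigraded component counts semistandard fillings. -/
theorem multiplicity_eq_card [NeZero k] {P : Set (Fin m → ℝ)}
    (hP : IsFullLatticePolytope P) (γ : MultiPartition k n) (ord : LinearOrder (Fin m → ℤ))
    (a' : Fin m → ℤ) (d : ℕ) (j : ℤ) :
    (Fintype.card (WreathProduct k n) : ℂ)⁻¹ * ∑ σ : WreathProduct k n,
      starRingEnd ℂ (γ.irreducibleCharacter σ) * (bigradedPieceRep k n P a' d j).character σ =
      Nat.card (γ.tableauFillings ord P a' d j) := by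
  have : Finite (pieceFillings n P a' d j) := finite_pieceFillings hP a' d j
  have : FiniteDimensional ℂ (bigradedPiece n P a' d j) :=
    Module.Finite.of_basis (pieceBasis hP a' d j)
  have h := Representation.card_inv_mul_sum_char_span_singleton (bigradedPieceRep k n P a' d j)
    γ.youngSymmetrizer
  rw [γ.finrank_range_youngSymmetrizer hP ord] at h
  -- Since the multiplicity is a natural number, the character of the left ideal may be conjugated
  -- by conjugating the whole formula and inverting `σ` in the explicit character.
  have h' := congrArg (starRingEnd ℂ) h
  rw [map_mul, map_inv₀, map_natCast, map_natCast, map_sum] at h'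
  rw [← h']
  congr 1
  refine Fintype.sum_equiv (Equiv.inv _) _ _ fun σ => ?_
  rw [Equiv.inv_apply, map_mul, conj_character_bigradedPieceRep hP, inv_inv, mul_comm]
  rfl

open Classical in
/-- All fillings by lattice points of `dP` which are semistandard with the right residues. -/
def allTableauFillings {P : Set (Fin m → ℝ)} (hP : IsFullLatticePolytope P)
    (γ : MultiPartition k n) (ord : LinearOrder (Fin m → ℤ)) (d : ℕ) :
    Finset (Fin n → Fin m → ℤ) :=
  (latticeFillings hP n d).filter fun T =>
    @MultiPartition.SemistandardFilling k n γ _ ord T ∧ γ.ResidueFilling T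

/-- The weights of the semistandard fillings, each of which contributes to the component of its own
combinatorial degree, add up to the graded multiplicity of `χ^γ`. -/
theorem inner_pieceCharacter [NeZero k] {P : Set (Fin m → ℝ)}
    (hP : IsFullLatticePolytope P) (γ : MultiPartition k n) (ord : LinearOrder (Fin m → ℤ))
    (a' : Fin m → ℤ) (d : ℕ) :
    WreathProduct.inner (pieceCharacter P a' d) γ.irreducibleCharacter =
      ∑ T ∈ allTableauFillings hP γ ord d, LaurentPolynomial.T (fillingDegree a' T) := by
  classical
  have hmaps : ∀ T ∈ allTableauFillings hP γ ord d,
      fillingDegree a' T ∈ (latticeFillings hP n d).image (fillingDegree a') := fun T hT =>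
    Finset.mem_image_of_mem _ (Finset.mem_filter.1 hT).1
  rw [WreathProduct.inner, ← Finset.sum_fiberwise_of_maps_to hmaps]
  simp only [pieceCharacter_eq_sum_components hP, Finset.smul_sum]
  rw [Finset.sum_comm]
  refine Finset.sum_congr rfl fun j _ => ?_
  have hcard : ((allTableauFillings hP γ ord d).filter fun T => fillingDegree a' T = j).card =
      Nat.card (γ.tableauFillings ord P a' d j) := by
    refine (Nat.subtype_card _ fun T => ?_).symm
    rw [Finset.mem_filter, allTableauFillings, Finset.mem_filter, mem_latticeFillings]
    exact ⟨fun h => ⟨h.1.2.1, h.1.2.2, h.1.1, h.2⟩, fun h => ⟨⟨h.2.2.1, h.1, h.2.1⟩, h.2.2.2⟩⟩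
  have hconst : ∑ T ∈ (allTableauFillings hP γ ord d).filter (fun T => fillingDegree a' T = j),
      (LaurentPolynomial.T (fillingDegree a' T) : LaurentPolynomial ℂ) =
      ∑ _T ∈ (allTableauFillings hP γ ord d).filter (fun T => fillingDegree a' T = j),
        LaurentPolynomial.T j :=
    Finset.sum_congr rfl fun T hT => by rw [(Finset.mem_filter.1 hT).2]
  rw [hconst, Finset.sum_const, hcard, ← Nat.cast_smul_eq_nsmul ℂ, ← multiplicity_eq_card hP γ ord, Finset.mul_sum, Finset.sum_smul]
  refine Finset.sum_congr rfl fun σ _ => ?_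
  rw [smul_smul, smul_smul, mul_assoc]

/-! ### Sequences of tableaux and fillings -/

/-- A filling of the numbered cells, regarded as a sequence of fillings of Young diagrams. -/
def toTableaux {α : Type*} (γ : MultiPartition k n) (f : Fin n → α) :
    ∀ r : Fin k, {c : ℕ × ℕ // c ∈ (γ.shape r).cells} → α :=
  fun r x => f (γ.numbering ⟨r, x⟩)

theorem toTableaux_injective {α : Type*} (γ : MultiPartition k n) :
    Function.Injective (toTableaux γ (α := α)) := by
  intro f g h
  funext i
  have := congrFun (congrFun h (γ.numbering.symm i).1) (γ.numbering.symm i).2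
  simpa [toTableaux] using this

theorem forall_letter_iff (γ : MultiPartition k n) (p : Fin n → Prop) :
    (∀ i, p i) ↔ ∀ r x, p (γ.numbering ⟨r, x⟩) := by
  refine ⟨fun h r x => h _, fun h i => ?_⟩
  have := h (γ.numbering.symm i).1 (γ.numbering.symm i).2
  simpa using this

/-- The bound by the multiplicities of the color rule only says which colors may be used: no color
can occur more than `n` times, as there are only `n` cells. -/
theorem toTableaux_mem_multiSSYT_iff {P : Set (Fin m → ℝ)} (hP : IsFullLatticePolytope P)
    (γ : MultiPartition k n) (ord : LinearOrder (Fin m → ℤ)) (a' : Fin m → ℤ) (d : ℕ)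
    (f : Fin n → Fin m → ℤ) :
    toTableaux γ f ∈ (polytopeColorRule n P a' d).multiSSYT ord γ ↔
      f ∈ allTableauFillings hP γ ord d := by
  classical
  have hcardle : ∀ r, Nat.card {c : ℕ × ℕ // c ∈ (γ.shape r).cells} ≤ n := by
    intro r
    rw [Nat.card_eq_fintype_card, Fintype.card_coe]
    calc (γ.shape r).cells.card ≤ ∑ r, (γ.shape r).card :=
          Finset.single_le_sum (f := fun r => (γ.shape r).card) (fun _ _ => Nat.zero_le _)
            (Finset.mem_univ r)
      _ = n := γ.card_eq
  have hmult : ∀ r, (∀ c, Nat.card {x // toTableaux γ f r x = c} ≤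
      ((polytopeColorRule n P a' d).residue k (r : ℕ)).mult c) ↔
      ∀ x, (∑ j, toTableaux γ f r x j) ≡ (r : ℕ) [ZMOD k] ∧
        toTableaux γ f r x ∈ dilationPoints P d := by
    intro r
    rw [← forall_card_le_iff (hcardle r) (toTableaux γ f r)
      (fun v => (∑ j, v j) ≡ (r : ℕ) [ZMOD k] ∧ v ∈ dilationPoints P d)]
    refine forall_congr' fun c => ?_
    rw [ite_and]
    rfl
  rw [allTableauFillings, Finset.mem_filter, mem_latticeFillings]
  constructor
  · intro h
    have hm := fun r => (hmult r).1 (h r).mult_le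
    refine ⟨(forall_letter_iff γ _).2 fun r x => (hm r x).2, ⟨?_, ?_⟩,
      (forall_letter_iff γ _).2 fun r x => ?_⟩
    · refine (forall_letter_iff γ _).2 fun r x => (forall_letter_iff γ _).2 fun r' y => ?_
      intro hb hr hc
      obtain ⟨x1, x2, x3⟩ := γ.numbering_spec r x
      obtain ⟨y1, y2, y3⟩ := γ.numbering_spec r' y
      rw [x1, y1] at hb
      subst hb
      rw [x2, y2] at hr
      rw [x3, y3] at hc
      exact (h r).row_weak x y hr hc
    · refine (forall_letter_iff γ _).2 fun r x => (forall_letter_iff γ _).2 fun r' y => ?_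
      intro hb hc hr
      obtain ⟨x1, x2, x3⟩ := γ.numbering_spec r x
      obtain ⟨y1, y2, y3⟩ := γ.numbering_spec r' y
      rw [x1, y1] at hb
      subst hb
      rw [x2, y2] at hr
      rw [x3, y3] at hc
      exact (h r).col_strict x y hc hr
    · rw [(γ.numbering_spec r x).1]
      exact (hm r x).1
  · rintro ⟨hd, hss, hres⟩ r
    refine ⟨(hmult r).2 fun x => ⟨?_, hd _⟩, fun x y hr hc => ?_, fun x y hc hr => ?_⟩
    · have := hres (γ.numbering ⟨r, x⟩)
      rwa [(γ.numbering_spec r x).1] at this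
    · obtain ⟨x1, x2, x3⟩ := γ.numbering_spec r x
      obtain ⟨y1, y2, y3⟩ := γ.numbering_spec r y
      exact hss.row_weak _ _ (x1.trans y1.symm) (by rw [x2, y2, hr]) (by rwa [x3, y3])
    · obtain ⟨x1, x2, x3⟩ := γ.numbering_spec r x
      obtain ⟨y1, y2, y3⟩ := γ.numbering_spec r y
      exact hss.col_strict _ _ (x1.trans y1.symm) (by rw [x3, y3, hc]) (by rwa [x2, y2])

theorem tableauWeight_toTableaux (P : Set (Fin m → ℝ)) (γ : MultiPartition k n)
    (a' : Fin m → ℤ) (d : ℕ) (f : Fin n → Fin m → ℤ) :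
    (polytopeColorRule n P a' d).tableauWeight (toTableaux γ f) =
      LaurentPolynomial.T (fillingDegree a' f) := by
  rw [fillingDegree, ← prod_T, ← Equiv.prod_comp γ.numbering, Fintype.prod_sigma]
  rfl

theorem sum_multiSSYT {P : Set (Fin m → ℝ)} (hP : IsFullLatticePolytope P)
    (γ : MultiPartition k n) (ord : LinearOrder (Fin m → ℤ)) (a' : Fin m → ℤ) (d : ℕ) :
    ∑ᶠ T ∈ (polytopeColorRule n P a' d).multiSSYT ord γ,
      (polytopeColorRule n P a' d).tableauWeight T =
      ∑ T ∈ allTableauFillings hP γ ord d, LaurentPolynomial.T (fillingDegree a' T) := by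
  have himage : (polytopeColorRule n P a' d).multiSSYT ord γ =
      toTableaux γ '' (allTableauFillings hP γ ord d : Set (Fin n → Fin m → ℤ)) := by
    ext T
    constructor
    · intro hT
      have e : toTableaux γ (fun i => T (γ.numbering.symm i).1 (γ.numbering.symm i).2) = T := by
        funext r x
        change T (γ.numbering.symm (γ.numbering ⟨r, x⟩)).1 _ = _
        rw [Equiv.symm_apply_apply]
      rw [← e] at hT
      exact ⟨_, (toTableaux_mem_multiSSYT_iff hP γ ord a' d _).1 hT, e⟩
    · rintro ⟨f, hf, rfl⟩
      exact (toTableaux_mem_multiSSYT_iff hP γ ord a' d f).2 hf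
  rw [himage, finsum_mem_image (toTableaux_injective γ).injOn, finsum_mem_coe_finset]
  exact Finset.sum_congr rfl fun f _ => tableauWeight_toTableaux P γ a' d f

theorem coeff_inner_bigradedCharacter [NeZero k] (P : Set (Fin m → ℝ)) (a' : Fin m → ℤ)
    (ψ : WreathProduct k n → ℂ) :
    WreathProduct.inner (bigradedCharacter P a') ψ =
      PowerSeries.mk fun d => WreathProduct.inner (pieceCharacter P a' d) ψ := by
  ext1 d
  rw [PowerSeries.coeff_mk, WreathProduct.inner, WreathProduct.inner]
  have hsmul : ∀ (c : ℂ) (x : PowerSeries (LaurentPolynomial ℂ)),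
      PowerSeries.coeff d (c • x) = c • PowerSeries.coeff d x := fun _ _ => rfl
  rw [hsmul, map_sum]
  simp only [hsmul]
  simp only [bigradedCharacter, PowerSeries.coeff_mk]
  rfl

end Multiplicity

theorem mainTheorem2 (k n m : ℕ) [NeZero k] (hn : 0 < n)
    (P : Set (Fin m → ℝ)) (hP : IsFullLatticePolytope P) (a' : Fin m → ℤ) :
    (∀ σ : WreathProduct k n,
      bigradedCharacter P a' σ = PowerSeries.mk (fun d => pieceCharacter P a' d σ) ∧
      bigradedCharacter P a' σ =
        PowerSeries.mk (fun d => (polytopeColorRule n P a' d).character σ)) ∧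
    ∀ (γ : MultiPartition k n) (ord : ℕ → LinearOrder (Fin m → ℤ)),
      WreathProduct.inner (bigradedCharacter P a') γ.irreducibleCharacter =
        PowerSeries.mk (fun d =>
          ∑ᶠ T ∈ (polytopeColorRule n P a' d).multiSSYT (ord d) γ,
            (polytopeColorRule n P a' d).tableauWeight T) := by
  refine ⟨fun σ => ⟨rfl, ?_⟩, fun γ ord => ?_⟩
  · simp only [character_polytopeColorRule hP]
    rfl
  · rw [coeff_inner_bigradedCharacter]
    congr 1
    funext d
    rw [inner_pieceCharacter hP γ (ord d), sum_multiSSYT hP]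

end
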